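/- Let $q\ge 0$ be an integer and $[q]=\{1,\dots,q\}$. For $c\ge 0$ let $\mathrm{Inc}^q(2\times c)$ be the set of fillings of the $2\times c$ rectangle with elements of $[q]$ that strictly increase along rows (left to right) and down columns. **Promotion digraph.** Let $T$ be a filling on an ordered alphabet $a_1<\dots<a_n$. *K-gromotion* of $T$ is defined as follows: replace the entry $a_1$, if it occurs, by $\bullet$; then, for $i=2,\dots,n$ in this order, simultaneously replace by $\bullet$ every entry $a_i$ that is in a box adjacent to a $\bullet$, and replace by $a_i$ every $\bullet$ that is in a box adjacent to such an entry $a_i$; finally replace all $\bullet$ by $a_1$. The result is viewed as a filling on the alphabet $a_2<\dots<a_n<a_1$. One says that $\beta=a_i$ *moves from row 2 to row 1* if in the step for $a_i$ some $\bullet$ in row 1 is replaced by $\beta$ while the entry $\beta$ immediately below it is replaced by $\bullet$. For $T\in\mathrm{Inc}^q(2\times c)$, with the alphabet $1<\dots<q$, the digraph $\mathsf{prom}_1(T)$ on $[q]$ has an arrow $\alpha\to\beta$ exactly if $\beta$ moves from row 2 to row 1 when K-gromotion is applied to the $(\alpha-1)$-st iterate of K-gromotion on $T$. **Trip digraph.**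 A plabic graph is a planar graph embedded in a disk, up to planar isotopy, with boundary vertices $b_1,\dots,b_n$ of degree 1 (in clockwise order) and every vertex coloured black or white. Its $(i,r)$-trip digraph $\mathsf{trip}_{i,r}$ on $[n]$ has an arrow $\alpha\to\beta$ exactly if one can reach $b_\beta$ by starting at $b_\alpha$, travelling along edges until a boundary vertex is reached, and leaving each internal vertex of degree $h$ by the $(i+\ell)$-th left if it is white, and by the $(i+\ell)$-th right if it is black, for some $0\le \ell\le h-r$ chosen at each visit (if $h<r$ there is no way to continue). The plabic graph of a noncrossing set partition of $[q]$ has black boundary vertices $b_1,\dots,b_q$ and, for each block, one white internal vertex joined to the boundary vertices in that block. **Statement.** For every $T\in\mathrm{Inc}^q(2\times c)$ there is a unique noncrossing set partition $\pi(T)$ of $[q]$ such that for every $i\in[q]$: $i$ is a singleton block if and only if $i$ does not appear in $T$; $i$ is the least element of a non-singleton block if and only if $i$ appears only in the top row of $T$; $i$ is the greatest element of a non-singleton block if and only if $i$ appears only in the bottom row of $T$; and $i$ is neither least nor greatest in its block if $i$ appears in both rows of $T$. The map $\pi$ is a bijection from $\bigsqcup_{c\ge 0}\mathrm{Inc}^q(2\times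 c)$ onto the set of noncrossing set partitions of $[q]$. Moreover, for all $c$ and all $T\in\mathrm{Inc}^q(2\times c)$, regarding $\pi(T)$ as a plabic graph, $$\mathsf{trip}_{1,2}(\pi(T))=\mathsf{prom}_1(T).$$ -/

import Mathlib

namespace TripProm

/-! ## Increasing tableaux, K-gromotion and promotion digraphs

Rows, columns and values are indexed from `0`; the value `k : Fin q` stands for the element
`k + 1` of the alphabet `{1, ..., q}`. -/

/-- An increasing tableau of rectangular shape `r × c` on the alphabet `{1 < ... < q}`. -/
@[ext]
structure IncTableau (r c q : ℕ) where
  entry : Fin r × Fin c → Fin q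
  row_strict : ∀ i, StrictMono fun j => entry (i, j)
  col_strict : ∀ j, StrictMono fun i => entry (i, j)

/-- Two boxes are adjacent if they share a side. -/
def BoxAdj {r c : ℕ} (b b' : Fin r × Fin c) : Prop :=
  (b.1 = b'.1 ∧ (b.2.val + 1 = b'.2.val ∨ b'.2.val + 1 = b.2.val)) ∨
    (b.2 = b'.2 ∧ (b.1.val + 1 = b'.1.val ∨ b'.1.val + 1 = b.1.val))

section Gromotion

variable {α : Type*} {r c : ℕ}

open Classical in
/-- The first step of K-gromotion: delete all entries `a`; `none` is the symbol `•`. -/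
noncomputable def deleteEntry (a : α) (T : Fin r × Fin c → α) : Fin r × Fin c → Option α :=
  fun b => if T b = a then none else some (T b)

open Classical in
/-- One iteration of the second step, for the letter `a`: boxes with entry `a` adjacent to a `•`
become `•`, and simultaneously boxes with `•` adjacent to a box with entry `a` become `a`. -/
noncomputable def slide (a : α) (S : Fin r × Fin c → Option α) : Fin r × Fin c → Option α :=
  fun b =>
    if S b = none ∧ ∃ b', BoxAdj b b' ∧ S b' = some a then some a
    else if S b = some a ∧ ∃ b', BoxAdj b b' ∧ S b' = none then none
    else S b

/-- The partial filling obtained from `T` by deleting the letter `a` and then performing the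
iterations of the second step for the letters in the list `L`, in this order. -/
noncomputable def slides (a : α) (L : List α) (T : Fin r × Fin c → α) :
    Fin r × Fin c → Option α :=
  L.foldl (fun S x => slide x S) (deleteEntry a T)

/-- K-gromotion of the filling `T` with respect to the ordered alphabet `A = (a₁ < ... < aₙ)`,
given as the list of its letters in increasing order. -/
noncomputable def gromote (A : List α) (T : Fin r × Fin c → α) : Fin r × Fin c → α :=
  match A with
  | [] => T
  | a :: L => fun b => (slides a L T b).getD a

/-- K-gromotion as a map on pairs of an ordered alphabet and a filling; the alphabet
`(a₁ < ... < aₙ)` becomes `(a₂ < ... < aₙ < a₁)`. -/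
noncomputable def gromotion (p : List α × (Fin r × Fin c → α)) :
    List α × (Fin r × Fin c → α) :=
  (p.1.rotate 1, gromote p.1 p.2)

/-- `β` moves from row `i + 1` to row `i` (rows numbered from `1`) during the K-gromotion of `T`
with respect to the ordered alphabet `A`: in the iteration for the letter `β` (the letters `L₁`
having been treated before), some `•` in a box `b` of row `i` is replaced by `β`, while the entry
`β` in the box `b'` immediately below `b` is replaced by `•`. -/
def MovesUp (A : List α) (T : Fin r × Fin c → α) (i : ℕ) (β : α) : Prop :=
  ∃ (a : α) (L₁ L₂ : List α), A = a :: (L₁ ++ β :: L₂) ∧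
    ∃ b b' : Fin r × Fin c,
      b.1.val + 1 = i ∧ b'.1.val = i ∧ b.2 = b'.2 ∧
      slides a L₁ T b = none ∧ slide β (slides a L₁ T) b = some β ∧
      slides a L₁ T b' = some β ∧ slide β (slides a L₁ T) b' = none

end Gromotion

/-- The `i`-th promotion digraph (`i ≥ 1`) of an increasing tableau: there is an arrow `α → β` if
`β` moves from row `i + 1` to row `i` when gromotion is applied to the `(α - 1)`-st iterate of
gromotion on `T` (values numbered from `1`, so that `α - 1` is the underlying number of
`α : Fin q`). -/
def IncTableau.prom {r c q : ℕ} (i : ℕ) (T : IncTableau r c q) : Digraph (Fin q) where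
  Adj α β :=
    let p := gromotion^[α.val] (List.finRange q, T.entry)
    MovesUp p.1 p.2 i β

/-! ## Plabic graphs and trip digraphs -/

/-- The number of classes of the equivalence relation generated by `R`. -/
noncomputable def classCount {D : Type} (R : D → D → Prop) : ℕ := Nat.card (Quot R)

/-- The clockwise rotation of half-edges after the boundary circle of the disk has been collapsed
to one point of the sphere. Around that point the boundary half-edges `bdart k` appear in the
cyclic order opposite to their clockwise order around the disk. -/
def cappedRot {n : ℕ} {V D : Type} (org : D → Fin n ⊕ V) (bdart : Fin n → D) (rot : D → D)
    (d : D) : D :=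
  match org d with
  | Sum.inl k => bdart ((finRotate n).symm k)
  | Sum.inr _ => rot d

inductive VertexColor
  | black
  | white

/-- A plabic graph with `n` boundary vertices, labelled clockwise around the disk, up to planar
isotopy. It is recorded by its half-edges (darts), the vertex at which each half-edge starts, the
involution `rev` exchanging the two halves of each edge, and the rotation `rot` sending each
half-edge to the next one in clockwise order around its vertex. Vertices are the boundary
vertices (`Sum.inl`) and the internal ones (`Sum.inr`). -/
structure PlabicGraph (n : ℕ) where
  /-- internal vertices -/
  Vertex : Type
  Dart : Type
  finite_vertex : Finite Vertex
  finite_dart : Finite Dart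
  color : Fin n ⊕ Vertex → VertexColor
  org : Dart → Fin n ⊕ Vertex
  rev : Equiv.Perm Dart
  rev_rev : ∀ d, rev (rev d) = d
  rev_ne : ∀ d, rev d ≠ d
  rot : Equiv.Perm Dart
  /-- the half-edges at a vertex form one cycle of the rotation -/
  org_eq_iff : ∀ d e, org d = org e ↔ rot.SameCycle d e
  /-- the half-edge at a boundary vertex -/
  bdart : Fin n → Dart
  /-- boundary vertices have degree `1` -/
  org_eq_bdry_iff : ∀ d k, org d = Sum.inl k ↔ d = bdart k
  /-- planarity: Euler's formula `V + F = E + 2C` on the sphere obtained by collapsing the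
  boundary circle of the disk (`C` is the number of connected components) -/
  planar :
    classCount (fun d e => cappedRot org bdart rot d = e) +
        classCount (fun d e => cappedRot org bdart rot (rev d) = e) =
      classCount (fun d e => rev d = e) +
        2 * classCount (fun d e => cappedRot org bdart rot d = e ∨ rev d = e)

namespace PlabicGraph

variable {n : ℕ} (G : PlabicGraph n)

/-- The degree of an internal vertex. -/
noncomputable def degree (v : G.Vertex) : ℕ := Nat.card {d : G.Dart // G.org d = Sum.inr v}

/-- The half-edge by which one leaves the internal vertex `v`, entered along the edge whose half
at `v` is `e`, when taking the `j`-th left (`v` white) or the `j`-th right (`v` black). The first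
left is the next edge after `e` in clockwise order, the first right the next one in
counterclockwise order. -/
def turn (v : G.Vertex) (j : ℕ) (e : G.Dart) : G.Dart :=
  match G.color (Sum.inr v) with
  | VertexColor.white => (G.rot ^ j) e
  | VertexColor.black => (G.rot⁻¹ ^ j) e

/-- After traversing an edge from the half-edge `d` to an internal vertex of degree `h`, an
`(i, r)`-trip may continue along the half-edge `d'`, the `(i + l)`-th left or right for some
`0 ≤ l ≤ h - r` (so there is no way to continue if `h < r`). -/
def TripStep (i r : ℕ) (d d' : G.Dart) : Prop :=
  ∃ v, G.org (G.rev d) = Sum.inr v ∧ ∃ l, l + r ≤ G.degree v ∧ d' = G.turn v (i + l) (G.rev d)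

/-- The `(i, r)`-trip digraph: there is an arrow `α → β` if some `(i, r)`-trip starting at the
boundary vertex `α` arrives at the boundary vertex `β`. -/
def trip (i r : ℕ) : Digraph (Fin n) where
  Adj α β := ∃ d, Relation.ReflTransGen (G.TripStep i r) (G.bdart α) d ∧
    G.org (G.rev d) = Sum.inl β

end PlabicGraph

/-! ## Noncrossing set partitions -/

/-- A noncrossing set partition of `{1, ..., q}`. -/
@[ext]
structure NoncrossingPartition (q : ℕ) where
  toFinpartition : Finpartition (Finset.univ : Finset (Fin q))
  noncrossing : ∀ a b c d : Fin q, a < b → b < c → c < d →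
    toFinpartition.part a = toFinpartition.part c →
    toFinpartition.part b = toFinpartition.part d →
    toFinpartition.part a = toFinpartition.part b

namespace NoncrossingPartition

variable {q : ℕ} (P : NoncrossingPartition q)

/-- The block containing `k`. -/
def block (k : Fin q) : Finset (Fin q) := P.toFinpartition.part k

/-- The blocks, as a type. -/
abbrev Block : Type := {B : Finset (Fin q) // B ∈ P.toFinpartition.parts}

theorem block_mem (k : Fin q) : P.block k ∈ P.toFinpartition.parts :=
  P.toFinpartition.part_mem.2 (Finset.mem_univ k)

theorem mem_block_iff {j k : Fin q} : j ∈ P.block k ↔ P.block j = P.block k :=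
  P.toFinpartition.mem_part_iff_part_eq_part (Finset.mem_univ _) (Finset.mem_univ _)

theorem self_mem_block (k : Fin q) : k ∈ P.block k := P.mem_block_iff.2 rfl

theorem block_formPerm (k : Fin q) : P.block ((P.block k).sort.formPerm k) = P.block k := by
  rw [← mem_block_iff, ← Finset.mem_sort (· ≤ ·)]
  exact List.formPerm_apply_mem_of_mem ((Finset.mem_sort _).2 (P.self_mem_block k))

theorem block_formPerm_inv (k : Fin q) :
    P.block ((P.block k).sort.formPerm⁻¹ k) = P.block k := by
  rw [← mem_block_iff, ← Finset.mem_sort (· ≤ ·), ← List.formPerm_mem_iff_mem]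
  simpa using P.self_mem_block k

/-- The permutation of `{1, ..., q}` which on each block `{b₁ < b₂ < ... < bₘ}` is the cycle
`b₁ → b₂ → ... → bₘ → b₁`, i.e. goes to the next element of the block in clockwise order. -/
def next : Equiv.Perm (Fin q) where
  toFun k := (P.block k).sort.formPerm k
  invFun k := (P.block k).sort.formPerm⁻¹ k
  left_inv k := by
    simp only [block_formPerm]
    exact Equiv.symm_apply_apply _ _
  right_inv k := by
    simp only [block_formPerm_inv]
    exact Equiv.apply_symm_apply _ _

theorem next_apply (k : Fin q) : P.next k = (P.block k).sort.formPerm k := rfl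

theorem block_next (k : Fin q) : P.block (P.next k) = P.block k := P.block_formPerm k

theorem next_pow_apply (k : Fin q) (m : ℕ) :
    (P.next ^ m) k = ((P.block k).sort.formPerm ^ m) k ∧
      P.block ((P.next ^ m) k) = P.block k := by
  induction m with
  | zero => simp
  | succ m ih =>
    rw [pow_succ', pow_succ', Equiv.Perm.mul_apply, Equiv.Perm.mul_apply, block_next]
    refine ⟨?_, ih.2⟩
    rw [next_apply, ih.2, ih.1]

theorem block_eq_iff_sameCycle {j k : Fin q} :
    P.block j = P.block k ↔ P.next.SameCycle j k := by
  constructor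
  · intro h
    have h1 : (P.block j).sort.formPerm.IsCycleOn {a | a ∈ (P.block j).sort} :=
      ((P.block j).sort_nodup (· ≤ ·)).isCycleOn_formPerm
    have h2 : k ∈ P.block j := P.mem_block_iff.2 h.symm
    have h3 : (P.block j).sort.formPerm.SameCycle j k :=
      h1.2 (by simpa using P.self_mem_block j) (by simpa using h2)
    obtain ⟨m, -, hm⟩ := h3.exists_pow_eq'
    exact ⟨m, by rw [zpow_natCast, (P.next_pow_apply j m).1, hm]⟩
  · intro h
    obtain ⟨m, -, hm⟩ := h.exists_pow_eq'
    rw [← hm, (P.next_pow_apply j m).2]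

/-! ### The plabic graph of a noncrossing set partition -/

theorem next_between {k m : Fin q} (h1 : k < m) (h2 : m < P.next k) : P.block m ≠ P.block k := by
  intro h
  have hs := (P.block k).sortedLT_sort
  have hk : k ∈ (P.block k).sort := by simpa using P.self_mem_block k
  have hm : m ∈ (P.block k).sort := by simpa using P.mem_block_iff.2 h
  rw [next_apply] at h2
  generalize (P.block k).sort = l at *
  obtain ⟨i, hi, rfl⟩ := List.mem_iff_getElem.1 hk
  obtain ⟨j, hj, rfl⟩ := List.mem_iff_getElem.1 hm
  have hij : i < j := (hs.getElem_lt_getElem_iff).1 h1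
  rw [List.formPerm_apply_lt_getElem l hs.nodup i (by omega)] at h2
  have := (hs.getElem_lt_getElem_iff).1 h2
  omega

theorem le_of_next_le {k m : Fin q} (h : P.next k ≤ k) (hb : P.block m = P.block k) :
    m ≤ k := by
  have hs := (P.block k).sortedLT_sort
  have hk : k ∈ (P.block k).sort := by simpa using P.self_mem_block k
  have hm : m ∈ (P.block k).sort := by simpa using P.mem_block_iff.2 hb
  clear hb
  rw [next_apply] at h
  generalize (P.block k).sort = l at *
  obtain ⟨i, hi, rfl⟩ := List.mem_iff_getElem.1 hk
  obtain ⟨j, hj, rfl⟩ := List.mem_iff_getElem.1 hm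
  by_contra hlt
  have hij : i < j := (hs.getElem_lt_getElem_iff).1 (not_le.1 hlt)
  rw [List.formPerm_apply_lt_getElem l hs.nodup i (by omega)] at h
  exact absurd h (not_le.2 ((hs.getElem_lt_getElem_iff).2 (by omega)))

/-- The half-edges of the plabic graph of `P`: for every `k` there is one edge, with half `inl k`
at the boundary vertex `k` and half `inr k` at the white vertex of the block of `k`. -/
def dartOrg : Fin q ⊕ Fin q → Fin q ⊕ P.Block
  | Sum.inl k => Sum.inl k
  | Sum.inr k => Sum.inr ⟨P.block k, P.block_mem k⟩

/-- The half-edges at the white vertex of a block `{b₁ < ... < bₘ}` are in clockwise cyclic order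
`b₁, ..., bₘ`. -/
def dartRot : Equiv.Perm (Fin q ⊕ Fin q) := Equiv.sumCongr (Equiv.refl _) P.next

theorem dartOrg_eq_iff (d e : Fin q ⊕ Fin q) :
    P.dartOrg d = P.dartOrg e ↔ P.dartRot.SameCycle d e := by
  have hl : ∀ (m : ℕ) k, (P.dartRot ^ m) (Sum.inl k) = Sum.inl k := by
    intro m k
    induction m with
    | zero => rfl
    | succ m ih => rw [pow_succ', Equiv.Perm.mul_apply, ih]; rfl
  have hr : ∀ (m : ℕ) k, (P.dartRot ^ m) (Sum.inr k) = Sum.inr ((P.next ^ m) k) := by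
    intro m k
    induction m with
    | zero => rfl
    | succ m ih => rw [pow_succ', Equiv.Perm.mul_apply, ih, pow_succ']; rfl
  constructor
  · intro h
    rcases d with j | j <;> rcases e with k | k <;> simp [dartOrg] at h
    · rw [h]
    · obtain ⟨m, -, hm⟩ := (P.block_eq_iff_sameCycle.1 h).exists_pow_eq'
      exact ⟨m, by rw [zpow_natCast, hr, hm]⟩
  · intro h
    obtain ⟨m, -, rfl⟩ := h.exists_pow_eq'
    rcases d with j | j
    · rw [hl]
    · rw [hr]; simp [dartOrg, (P.next_pow_apply j m).2]

theorem classCount_eq_of_map {D X : Type} (R : D → D → Prop) (g : D → X)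
    (hR : ∀ d e, R d e → g d = g e) (hs : Function.Surjective g)
    (hi : ∀ d e, g d = g e → Quot.mk R d = Quot.mk R e) : classCount R = Nat.card X := by
  refine Nat.card_congr (Equiv.ofBijective (Quot.lift g hR) ⟨?_, ?_⟩)
  · rintro ⟨d⟩ ⟨e⟩ h
    exact hi d e h
  · intro x
    obtain ⟨d, rfl⟩ := hs x
    exact ⟨Quot.mk _ d, rfl⟩

theorem rotate_symm_val {n : ℕ} (k : Fin (n + 1)) :
    (k = 0 ∧ (finRotate (n + 1)).symm k = Fin.last n) ∨
      (k ≠ 0 ∧ ((finRotate (n + 1)).symm k).val + 1 = k.val) := by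
  by_cases h : k = 0
  · refine Or.inl ⟨h, ?_⟩
    rw [Equiv.symm_apply_eq, finRotate_last, h]
  · refine Or.inr ⟨h, ?_⟩
    have h1 := coe_finRotate_symm_of_ne_zero h
    have h2 : k.val ≠ 0 := fun hk => h (Fin.ext hk)
    omega

theorem card_ascents_add :
    Nat.card {k : Fin q // k < P.next k} + Nat.card P.Block = q := by
  have h1 : Nat.card P.Block = Nat.card {k : Fin q // ¬ k < P.next k} := by
    symm
    refine Nat.card_congr (Equiv.ofBijective (fun k => ⟨P.block k.1, P.block_mem k.1⟩) ⟨?_, ?_⟩)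
    · rintro ⟨j, hj⟩ ⟨k, hk⟩ h
      have h : P.block j = P.block k := by simpa using h
      exact Subtype.ext (le_antisymm (P.le_of_next_le (not_lt.1 hk) h)
        (P.le_of_next_le (not_lt.1 hj) h.symm))
    · rintro ⟨B, hB⟩
      have hne := P.toFinpartition.nonempty_of_mem_parts hB
      have hb : P.block (B.max' hne) = B :=
        P.toFinpartition.part_eq_of_mem hB (B.max'_mem hne)
      refine ⟨⟨B.max' hne, not_lt.2 (B.le_max' _ ?_)⟩, Subtype.ext hb⟩
      have := P.self_mem_block (P.next (B.max' hne))
      rwa [P.block_next, hb] at this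
  rw [h1, Nat.card_eq_fintype_card, Nat.card_eq_fintype_card, Fintype.card_subtype_compl,
    Fintype.card_fin]
  have := Fintype.card_subtype_le (fun k : Fin q => k < P.next k)
  rw [Fintype.card_fin] at this
  omega

/-- `k < m ≤ next k` is preserved when going around a face. -/
theorem next_mem_gap_iff {k m : Fin q} (hk : k < P.next k) :
    (k < P.next m ∧ P.next m ≤ P.next k) ↔ (k ≤ m ∧ m < P.next k) := by
  have hbm := P.block_next m
  have hbk := P.block_next k
  constructor
  · rintro ⟨h1, h2⟩
    rcases h2.eq_or_lt with h2 | h2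
    · rw [P.next.injective h2]
      exact ⟨le_rfl, hk⟩
    · have hne := P.next_between h1 h2
      rw [hbm] at hne
      refine ⟨not_lt.1 fun h => hne ?_, not_le.1 fun h => hne ?_⟩
      · exact P.noncrossing m k (P.next m) (P.next k) h h1 h2 hbm.symm hbk.symm
      · rcases h.eq_or_lt with h | h
        · rw [← h, hbk]
        · have := P.noncrossing k (P.next m) (P.next k) m h1 h2 h hbk.symm hbm
          exact hbm.symm.trans this.symm
  · rintro ⟨h1, h2⟩
    rcases h1.eq_or_lt with h1 | h1
    · rw [← h1]
      exact ⟨hk, le_rfl⟩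
    · have hne := P.next_between h1 h2
      refine ⟨not_le.1 fun h => hne ?_, not_lt.1 fun h => hne ?_⟩
      · rcases h.eq_or_lt with h | h
        · rw [← hbm, h]
        · have := P.noncrossing (P.next m) k m (P.next k) h h1 h2 hbm hbk.symm
          exact hbm.symm.trans this
      · have := P.noncrossing k m (P.next k) (P.next m) h1 h2 h hbk.symm hbm.symm
        exact this.symm

section Planarity

theorem classCount_vertices {n : ℕ} (P : NoncrossingPartition (n + 1)) :
    classCount (fun d e => cappedRot P.dartOrg Sum.inl P.dartRot d = e) =
      Nat.card P.Block + 1 := by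
  set R : Fin (n + 1) ⊕ Fin (n + 1) → Fin (n + 1) ⊕ Fin (n + 1) → Prop :=
    fun d e => cappedRot P.dartOrg Sum.inl P.dartRot d = e with hR
  have h0 : ∀ m : ℕ, ∀ k : Fin (n + 1), k.val = m →
      Quot.mk R (Sum.inl k) = Quot.mk R (Sum.inl 0) := by
    intro m
    induction m with
    | zero => intro k hk; rw [show k = 0 from Fin.ext hk]
    | succ m ih =>
      intro k hk
      rcases rotate_symm_val k with ⟨h, -⟩ | ⟨-, h⟩
      · rw [h]
      · rw [← ih _ (by omega : ((finRotate (n + 1)).symm k).val = m)]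
        exact Quot.sound rfl
  have h1 : ∀ (m : ℕ) k, Quot.mk R (Sum.inr k) = Quot.mk R (Sum.inr ((P.next ^ m) k)) := by
    intro m k
    induction m with
    | zero => rfl
    | succ m ih =>
      rw [ih, pow_succ', Equiv.Perm.mul_apply]
      exact Quot.sound rfl
  rw [← Finite.card_option]
  refine classCount_eq_of_map R
    (Sum.elim (fun _ => none) fun k => some ⟨P.block k, P.block_mem k⟩) ?_ ?_ ?_
  · rintro (j | j) e rfl
    · rfl
    · simp [cappedRot, dartOrg, dartRot, block_next]
  · rintro (_ | ⟨B, hB⟩)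
    · exact ⟨Sum.inl 0, rfl⟩
    · obtain ⟨k, hk⟩ := P.toFinpartition.nonempty_of_mem_parts hB
      exact ⟨Sum.inr k, by simp [block, P.toFinpartition.part_eq_of_mem hB hk]⟩
  · rintro (j | j) (k | k) h
    · rw [h0 _ j rfl, h0 _ k rfl]
    · simp at h
    · simp at h
    · have h : P.block j = P.block k := by simpa using h
      obtain ⟨m, -, hm⟩ := (P.block_eq_iff_sameCycle.1 h).exists_pow_eq'
      rw [h1 m j, hm]

theorem classCount_edges (n : ℕ) :
    classCount (fun d e => Equiv.sumComm (Fin n) (Fin n) d = e) = n := by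
  conv_rhs => rw [← Nat.card_fin n]
  refine classCount_eq_of_map _ (Sum.elim id id) ?_ ?_ ?_
  · rintro (j | j) e rfl <;> rfl
  · exact fun k => ⟨Sum.inl k, rfl⟩
  · rintro (j | j) (k | k) h <;> obtain rfl : j = k := h
    · rfl
    · exact Quot.sound rfl
    · exact Quot.sound rfl
    · rfl

theorem classCount_components {n : ℕ} (P : NoncrossingPartition (n + 1)) :
    classCount (fun d e => cappedRot P.dartOrg Sum.inl P.dartRot d = e ∨
      Equiv.sumComm (Fin (n + 1)) (Fin (n + 1)) d = e) = 1 := by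
  set R : Fin (n + 1) ⊕ Fin (n + 1) → Fin (n + 1) ⊕ Fin (n + 1) → Prop :=
    fun d e => cappedRot P.dartOrg Sum.inl P.dartRot d = e ∨
      Equiv.sumComm (Fin (n + 1)) (Fin (n + 1)) d = e with hR
  have h0 : ∀ m : ℕ, ∀ k : Fin (n + 1), k.val = m →
      Quot.mk R (Sum.inl k) = Quot.mk R (Sum.inl 0) := by
    intro m
    induction m with
    | zero => intro k hk; rw [show k = 0 from Fin.ext hk]
    | succ m ih =>
      intro k hk
      rcases rotate_symm_val k with ⟨h, -⟩ | ⟨-, h⟩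
      · rw [h]
      · rw [← ih _ (by omega : ((finRotate (n + 1)).symm k).val = m)]
        exact Quot.sound (Or.inl rfl)
  have h1 : ∀ d, Quot.mk R d = Quot.mk R (Sum.inl 0) := by
    rintro (k | k)
    · exact h0 _ k rfl
    · rw [← h0 _ k rfl]
      exact Quot.sound (Or.inr rfl)
  refine Eq.trans ?_ (Nat.card_unique (α := Unit))
  exact classCount_eq_of_map R (fun _ => ()) (fun _ _ _ => rfl) (fun _ => ⟨Sum.inl 0, rfl⟩)
    fun d e _ => (h1 d).trans (h1 e).symm

theorem classCount_faces {n : ℕ} (P : NoncrossingPartition (n + 1)) :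
    classCount (fun d e => cappedRot P.dartOrg Sum.inl P.dartRot
      (Equiv.sumComm (Fin (n + 1)) (Fin (n + 1)) d) = e) =
      Nat.card {k : Fin (n + 1) // k < P.next k} + 1 := by
  set R : Fin (n + 1) ⊕ Fin (n + 1) → Fin (n + 1) ⊕ Fin (n + 1) → Prop :=
    fun d e => cappedRot P.dartOrg Sum.inl P.dartRot
      (Equiv.sumComm (Fin (n + 1)) (Fin (n + 1)) d) = e with hR
  let g : Fin (n + 1) → Fin (n + 1) ⊕ Fin (n + 1) → Prop := fun k =>
    Sum.elim (fun m => k ≤ m ∧ m < P.next k) fun m => k < m ∧ m ≤ P.next k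
  have hg : ∀ k, k < P.next k → ∀ d e, R d e → g k d = g k e := by
    rintro k hk (m | m) e rfl
    · exact propext (P.next_mem_gap_iff hk).symm
    · change (k < m ∧ m ≤ P.next k) =
        (k ≤ (finRotate (n + 1)).symm m ∧ (finRotate (n + 1)).symm m < P.next k)
      rcases rotate_symm_val m with ⟨h, h'⟩ | ⟨h, h'⟩
      · rw [h', h]
        have := Fin.le_last (P.next k)
        simp only [Fin.not_lt_zero, false_and, not_lt.2 this, and_false]
      · simp only [Fin.lt_def, Fin.le_def, eq_iff_iff]
        omega
  have hq : ∀ k, k < P.next k → ∀ d e, Quot.mk R d = Quot.mk R e → (g k d ↔ g k e) :=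
    fun k hk d e h => iff_of_eq (congrArg (Quot.lift (g k) (hg k hk)) h)
  have hstep : ∀ m, Quot.mk R (Sum.inl m) =
      Quot.mk R (Sum.inl ((finRotate (n + 1)).symm (P.next m))) := fun m =>
    (Quot.sound (r := R) (a := Sum.inl m) (b := Sum.inr (P.next m)) rfl).trans
      (Quot.sound (r := R) (a := Sum.inr (P.next m)) rfl)
  rw [← Finite.card_option]
  symm
  let h : Option {k : Fin (n + 1) // k < P.next k} → Quot R := fun o =>
    o.elim (Quot.mk R (Sum.inl (Fin.last n))) fun k => Quot.mk R (Sum.inl k.1)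
  refine Nat.card_congr (Equiv.ofBijective h ⟨?_, ?_⟩)
  · have key : ∀ k : {k : Fin (n + 1) // k < P.next k},
        Quot.mk R (Sum.inl (Fin.last n)) ≠ Quot.mk R (Sum.inl k.1) := by
      rintro ⟨k, hk⟩ he
      have := (hq k hk _ _ he).2 ⟨le_rfl, hk⟩
      exact absurd (Fin.le_last (P.next k)) (not_le.2 this.2)
    rintro (_ | j) (_ | k) he
    · rfl
    · exact absurd he (key k)
    · exact absurd he.symm (key j)
    · have h1 := (hq k.1 k.2 _ _ he).2 ⟨le_rfl, k.2⟩
      have h2 := (hq j.1 j.2 _ _ he).1 ⟨le_rfl, j.2⟩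
      exact congrArg some (Subtype.ext (le_antisymm h2.1 h1.1))
  · have hl : ∀ N : ℕ, ∀ m : Fin (n + 1), m.val < N → ∃ o, h o = Quot.mk R (Sum.inl m) := by
      intro N
      induction N with
      | zero => intro m hm; omega
      | succ N ih =>
        intro m hm
        by_cases hlt : m < P.next m
        · exact ⟨some ⟨m, hlt⟩, rfl⟩
        · rw [hstep m]
          rcases rotate_symm_val (P.next m) with ⟨-, h'⟩ | ⟨-, h'⟩
          · exact ⟨none, by rw [h']; rfl⟩
          · refine ih _ ?_
            rw [Fin.lt_def] at hlt
            omega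
    rintro ⟨m | m⟩
    · exact hl _ m (Nat.lt_succ_self _)
    · obtain ⟨o, ho⟩ := hl _ ((finRotate (n + 1)).symm m) (Nat.lt_succ_self _)
      refine ⟨o, ho.trans ?_⟩
      exact (Quot.sound (r := R) (a := Sum.inr m)
        (b := Sum.inl ((finRotate (n + 1)).symm m)) rfl).symm

theorem planar :
    classCount (fun d e => cappedRot P.dartOrg Sum.inl P.dartRot d = e) +
        classCount (fun d e => cappedRot P.dartOrg Sum.inl P.dartRot
          (Equiv.sumComm (Fin q) (Fin q) d) = e) =
      classCount (fun d e => Equiv.sumComm (Fin q) (Fin q) d = e) +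
        2 * classCount (fun d e => cappedRot P.dartOrg Sum.inl P.dartRot d = e ∨
          Equiv.sumComm (Fin q) (Fin q) d = e) := by
  cases q with
  | zero =>
    have h : ∀ R : Fin 0 ⊕ Fin 0 → Fin 0 ⊕ Fin 0 → Prop, classCount R = 0 := by
      intro R
      have : IsEmpty (Quot R) := ⟨by rintro ⟨d⟩; exact isEmptyElim d⟩
      exact Nat.card_of_isEmpty
    simp only [h]
  | succ n =>
    rw [classCount_vertices, classCount_faces, classCount_edges, classCount_components]
    have := P.card_ascents_add
    omega

end Planarity

/-- The plabic graph of a noncrossing set partition: every `k` is a black boundary vertex, every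
block is a white internal vertex, and the white vertex of a block is joined by one edge to each
boundary vertex in that block. -/
def toPlabicGraph : PlabicGraph q where
  Vertex := P.Block
  Dart := Fin q ⊕ Fin q
  finite_vertex := inferInstance
  finite_dart := inferInstance
  color := Sum.elim (fun _ => VertexColor.black) fun _ => VertexColor.white
  org := P.dartOrg
  rev := Equiv.sumComm (Fin q) (Fin q)
  rev_rev d := by simp
  rev_ne d := by cases d <;> simp
  rot := P.dartRot
  org_eq_iff := P.dartOrg_eq_iff
  bdart := Sum.inl
  org_eq_bdry_iff d k := by cases d <;> simp [dartOrg]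
  planar := P.planar

/-- The defining property of the noncrossing set partition `π(T)` attached to a two-row
rectangular increasing tableau `T`. -/
def IsAssociated {c : ℕ} (T : IncTableau 2 c q) : Prop :=
  let InTop (i : Fin q) : Prop := ∃ j, T.entry (0, j) = i
  let InBottom (i : Fin q) : Prop := ∃ j, T.entry (1, j) = i
  ∀ i : Fin q,
    (P.block i = {i} ↔ ¬ InTop i ∧ ¬ InBottom i) ∧
    ((P.block i ≠ {i} ∧ ∀ k ∈ P.block i, i ≤ k) ↔ InTop i ∧ ¬ InBottom i) ∧
    ((P.block i ≠ {i} ∧ ∀ k ∈ P.block i, k ≤ i) ↔ ¬ InTop i ∧ InBottom i) ∧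
    (InTop i ∧ InBottom i → (¬ ∀ k ∈ P.block i, i ≤ k) ∧ ¬ ∀ k ∈ P.block i, k ≤ i)

end NoncrossingPartition
end TripProm

namespace TripProm

/-! ## Noncrossing equivalence relations and their openers and closers -/

/-! Both digraphs turn out to be the same relation: an arrow goes from `x` to `y` exactly when `x`
and `y` are distinct elements of one block of `π(T)`.

A noncrossing equivalence relation on a linear order is determined by its openers (elements that are
not last in their class) and its closers (elements that are not first), by `IsNC.unique`. The four
conditions defining `π(T)` say precisely that the openers are the top row and the closers the bottom
row (`isAssociated_iff`). Existence is parenthesis matching, where strict columns give the ballot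
condition (`isNC_of_rows`). Conversely, listing openers and closers in increasing order recovers the
tableau, which gives bijectivity.

For promotion, let the first letter `a` occur, and let `u` and `d` be the ranks of the rows. The
hole in the top row travels right up to the first column `e` with `d e < u (e + 1)`, where `d e`
moves up. A hole enters the bottom row at the first column `k` with `d k ≤ u (k + 1)` and travels to
the end, where `a` is inserted. The letters that move up are the `d j` with `j ≤ e` and `d j ≤ u (j
+ 1)`. Measured by heights, these are exactly the other members of the class of `a`
(`TwoRows.conn_zero_iff`, `Adapted.movesUp_iff`).

The same class explains why the relation survives. When `a` becomes the last letter, it stops being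
an opener and becomes a closer, `d e` (formerly last in the class) becomes an opener, and `d k`
(formerly next after `a`) stops being a closer. The rows change in just this way, so one fixed
relation stays associated with every iterate (`Adapted.gromote`). The iterate used for the arrows
from `x` has `x` as first letter, which settles the promotion digraph. On the plabic side, a trip
from `x` visits one white vertex and may leave it along any edge but the one it came by
(`trip_one_two_adj_iff`). -/

/-- `r` is an equivalence relation, noncrossing for the order given by `ρ`; the elements which are
not the last one of their class form `U`, those which are not the first one form `D`. -/
structure IsNC {α : Type*} (ρ : α → ℕ) (r : α → α → Prop) (U D : Set α) : Prop where
  equiv : Equivalence r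
  noncrossing : ∀ a b c d, ρ a < ρ b → ρ b < ρ c → ρ c < ρ d → r a c → r b d → r a b
  mem_left : ∀ x, x ∈ U ↔ ∃ k, ρ x < ρ k ∧ r x k
  mem_right : ∀ x, x ∈ D ↔ ∃ k, ρ k < ρ x ∧ r k x

theorem exists_minimal_value {α : Type*} (f : α → ℕ) {p : α → Prop} (h : ∃ k, p k) :
    ∃ k, p k ∧ ∀ z, p z → f k ≤ f z := by
  obtain ⟨k, hk, hm⟩ := (measure f).wf.has_min {k | p k} h
  exact ⟨k, hk, fun z hz => not_lt.1 (hm z hz)⟩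

/-- `y` is the next element after `x` in its class. -/
def Arc {α : Type*} (ρ : α → ℕ) (r : α → α → Prop) (x y : α) : Prop :=
  ρ x < ρ y ∧ r x y ∧ ∀ z, ρ x < ρ z → ρ z < ρ y → ¬ r x z

namespace IsNC

variable {α : Type*} {ρ : α → ℕ} {r s : α → α → Prop} {U D : Set α}

theorem exists_arc_from (h : IsNC ρ r U D) {x : α} (hx : x ∈ U) : ∃ y, Arc ρ r x y := by
  obtain ⟨y, ⟨h1, h2⟩, h3⟩ := exists_minimal_value ρ ((h.mem_left x).1 hx)
  exact ⟨y, h1, h2, fun z hz1 hz2 hz => absurd (h3 z ⟨hz1, hz⟩) (not_le.2 hz2)⟩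

theorem exists_arc_to (h : IsNC ρ r U D) {y : α} (hy : y ∈ D) : ∃ x, Arc ρ r x y := by
  obtain ⟨x, ⟨h1, h2⟩, h3⟩ := exists_minimal_value (fun z => ρ y - ρ z) ((h.mem_right y).1 hy)
  refine ⟨x, h1, h2, fun z hz1 hz2 hz => ?_⟩
  have := h3 z ⟨hz2, h.equiv.trans (h.equiv.symm hz) h2⟩
  omega

/-- Induction on the span of the arc, with `r` and `s` quantified inside so that the induction
hypothesis can be used in both directions. An arc of `s` that is strictly shorter than the given one
is also an arc of `r`, and would then contradict that `x` and `y` are consecutive for `r`. -/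
theorem arc_of_arc (hρ : Function.Injective ρ) (n : ℕ) :
    ∀ {r s : α → α → Prop}, IsNC ρ r U D → IsNC ρ s U D → ∀ {x y}, ρ y ≤ ρ x + n →
      Arc ρ r x y → Arc ρ s x y := by
  induction n with
  | zero => intro r s hr hs x y hn h; exact absurd h.1 (by omega)
  | succ n ih =>
    rintro r s hr hs x y hn ⟨h1, h2, h3⟩
    obtain ⟨z, hz⟩ := hs.exists_arc_from ((hr.mem_left x).2 ⟨y, h1, h2⟩)
    rcases lt_trichotomy (ρ z) (ρ y) with h | h | h
    · have := ih hs hr (by omega) hz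
      exact absurd this.2.1 (h3 z hz.1 h)
    · rwa [← hρ h]
    -- The `s`-arc from `x` overshoots `y`. The `s`-arc ending at `y` then either crosses it, starts
    -- at `x` itself, or is shorter than the given arc.
    · exfalso
      obtain ⟨w, hw⟩ := hs.exists_arc_to ((hr.mem_right y).2 ⟨x, h1, h2⟩)
      rcases lt_trichotomy (ρ w) (ρ x) with h' | h' | h'
      · have := hs.noncrossing w x y z h' h1 h hw.2.1 hz.2.1
        exact hz.2.2 y h1 h (hs.equiv.trans (hs.equiv.symm this) hw.2.1)
      · rw [hρ h'] at hw
        exact hz.2.2 y h1 h hw.2.1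
      · have hwr := ih hs hr (by have := hw.1; omega) hw
        exact h3 w h' hw.1 (hr.equiv.trans h2 (hr.equiv.symm hwr.2.1))

theorem imp_of_lt (hρ : Function.Injective ρ) (hr : IsNC ρ r U D) (hs : IsNC ρ s U D) (n : ℕ) :
    ∀ {x y}, ρ y ≤ ρ x + n → ρ x < ρ y → r x y → s x y := by
  induction n with
  | zero => intro x y h1 h2; omega
  | succ n ih =>
    intro x y hn h1 h2
    obtain ⟨z, hz⟩ := hr.exists_arc_from ((hr.mem_left x).2 ⟨y, h1, h2⟩)
    have hs1 := (arc_of_arc hρ _ hr hs (Nat.le_add_left _ _) hz).2.1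
    have hz1 := hz.1
    rcases lt_trichotomy (ρ z) (ρ y) with h | h | h
    · exact hs.equiv.trans hs1
        (ih (by omega) h (hr.equiv.trans (hr.equiv.symm hz.2.1) h2))
    · rwa [← hρ h]
    · exact absurd h2 (hz.2.2 y h1 h)

theorem imp (hρ : Function.Injective ρ) (hr : IsNC ρ r U D) (hs : IsNC ρ s U D) {x y : α}
    (h : r x y) : s x y := by
  rcases lt_trichotomy (ρ x) (ρ y) with h' | h' | h'
  · exact imp_of_lt hρ hr hs _ (Nat.le_add_left _ _) h' h
  · rw [hρ h']; exact hs.equiv.refl _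
  · exact hs.equiv.symm (imp_of_lt hρ hr hs _ (Nat.le_add_left _ _) h' (hr.equiv.symm h))

/-- A noncrossing equivalence relation is determined by its openers and closers. -/
theorem unique (hρ : Function.Injective ρ) (hr : IsNC ρ r U D) (hs : IsNC ρ s U D) {x y : α} :
    r x y ↔ s x y :=
  ⟨hr.imp hρ hs, hs.imp hρ hr⟩

/-- Nothing is lost by restricting to the range of `ρ`: any number related to a different one is an
opener or a closer, hence the image of an element of `U` or `D`. -/
theorem comap {R : ℕ → ℕ → Prop} (hρ : Function.Injective ρ)
    (h : IsNC id R (ρ '' U) (ρ '' D)) : IsNC ρ (fun x y => R (ρ x) (ρ y)) U D where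
  equiv := ⟨fun _ => h.equiv.refl _, fun h' => h.equiv.symm h', fun h1 h2 => h.equiv.trans h1 h2⟩
  noncrossing a b c d := h.noncrossing _ _ _ _
  mem_left x := by
    rw [← hρ.mem_set_image, h.mem_left]
    refine ⟨?_, fun ⟨k, hk⟩ => ⟨ρ k, hk⟩⟩
    rintro ⟨k, h1, h2⟩
    obtain ⟨y, -, rfl⟩ := (h.mem_right k).2 ⟨_, h1, h2⟩
    exact ⟨y, h1, h2⟩
  mem_right x := by
    rw [← hρ.mem_set_image, h.mem_right]
    refine ⟨?_, fun ⟨k, hk⟩ => ⟨ρ k, hk⟩⟩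
    rintro ⟨k, h1, h2⟩
    obtain ⟨y, -, rfl⟩ := (h.mem_left k).2 ⟨_, h1, h2⟩
    exact ⟨y, h1, h2⟩

end IsNC

/-! ## Existence: parenthesis matching by heights -/

open Classical in
/-- The number of elements of `S` below `n`. -/
noncomputable def countBelow (S : Set ℕ) (n : ℕ) : ℕ := Nat.count (· ∈ S) n

theorem countBelow_succ_of_mem {S : Set ℕ} {n : ℕ} (h : n ∈ S) :
    countBelow S (n + 1) = countBelow S n + 1 := by
  simp [countBelow, Nat.count_succ, h]

theorem countBelow_succ_of_notMem {S : Set ℕ} {n : ℕ} (h : n ∉ S) :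
    countBelow S (n + 1) = countBelow S n := by
  simp [countBelow, Nat.count_succ, h]

theorem countBelow_mono (S : Set ℕ) {m n : ℕ} (h : m ≤ n) : countBelow S m ≤ countBelow S n :=
  open Classical in Nat.count_monotone _ h

theorem countBelow_zero (S : Set ℕ) : countBelow S 0 = 0 := by
  open Classical in exact Nat.count_zero _

theorem countBelow_range {c : ℕ} {u : Fin c → ℕ} (hu : StrictMono u) (n : ℕ) :
    countBelow (Set.range u) n = (Finset.univ.filter fun i => u i < n).card := by
  classical
  rw [countBelow, Nat.count_eq_card_filter_range, ← Finset.card_image_of_injective _ hu.injective]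
  congr 1
  ext x
  simp only [Finset.mem_filter, Finset.mem_range, Set.mem_range, Finset.mem_image,
    Finset.mem_univ, true_and]
  constructor
  · rintro ⟨h, i, rfl⟩
    exact ⟨i, h, rfl⟩
  · rintro ⟨i, h, rfl⟩
    exact ⟨h, i, rfl⟩

theorem lt_countBelow_range {c : ℕ} {u : Fin c → ℕ} (hu : StrictMono u) (n : ℕ) (j : Fin c) :
    j.val < countBelow (Set.range u) n ↔ u j < n := by
  rw [countBelow_range hu]
  constructor
  · intro h
    by_contra h'
    have : (Finset.univ.filter fun i => u i < n) ⊆ Finset.Iio j := by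
      intro i hi
      rw [Finset.mem_filter] at hi
      exact Finset.mem_Iio.2 (hu.lt_iff_lt.1 (by omega))
    have := Finset.card_le_card this
    rw [Fin.card_Iio] at this
    omega
  · intro h
    have : Finset.Iic j ⊆ (Finset.univ.filter fun i => u i < n) := by
      intro i hi
      have := hu.monotone (Finset.mem_Iic.1 hi)
      simp only [Finset.mem_filter, Finset.mem_univ, true_and]
      omega
    have := Finset.card_le_card this
    rw [Fin.card_Iic] at this
    omega

theorem countBelow_range_le {c : ℕ} {u : Fin c → ℕ} (hu : StrictMono u) (n : ℕ) :
    countBelow (Set.range u) n ≤ c := by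
  rw [countBelow_range hu]
  exact (Finset.card_le_univ _).trans_eq (Fintype.card_fin c)

/-- The height at `x`, after closing the arc which ends at `x` and before opening the one which
starts there. -/
noncomputable def midHeight (U D : Set ℕ) (x : ℕ) : ℤ := countBelow U x - countBelow D (x + 1)

/-- The height between `x` and `x + 1`. -/
noncomputable def gapHeight (U D : Set ℕ) (x : ℕ) : ℤ :=
  countBelow U (x + 1) - countBelow D (x + 1)

/-- `a` and `b` are connected by a chain of matched parentheses. -/
def Conn (U D : Set ℕ) (a b : ℕ) : Prop :=
  midHeight U D a = midHeight U D b ∧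
    ∀ x, (a ≤ x ∨ b ≤ x) → (x < a ∨ x < b) → midHeight U D a < gapHeight U D x

theorem midHeight_facts (U D : Set ℕ) (x : ℕ) :
    (x ∈ U → gapHeight U D x = midHeight U D x + 1) ∧
    (x ∉ U → gapHeight U D x = midHeight U D x) ∧
    (x + 1 ∈ D → gapHeight U D x = midHeight U D (x + 1) + 1) ∧
    (x + 1 ∉ D → gapHeight U D x = midHeight U D (x + 1)) := by
  refine ⟨fun h => ?_, fun h => ?_, fun h => ?_, fun h => ?_⟩ <;>
    simp only [midHeight, gapHeight, countBelow_succ_of_mem, countBelow_succ_of_notMem, h,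
      not_false_eq_true] <;> push_cast <;> ring

/-- Heights move by at most one between neighbouring positions. This discrete continuity turns the
inequalities at extremal positions below into equalities. -/
theorem midHeight_le_gapHeight (U D : Set ℕ) (x : ℕ) :
    midHeight U D x ≤ gapHeight U D x ∧ gapHeight U D x ≤ midHeight U D x + 1 ∧
    midHeight U D (x + 1) ≤ gapHeight U D x ∧ gapHeight U D x ≤ midHeight U D (x + 1) + 1 := by
  obtain ⟨h1, h2, h3, h4⟩ := midHeight_facts U D x
  by_cases hu : x ∈ U <;> by_cases hd : x + 1 ∈ D <;> simp only [hu, hd, not_true_eq_false,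
    not_false_eq_true, forall_true_left, false_imp_iff] at h1 h2 h3 h4 <;> omega

theorem conn_equivalence (U D : Set ℕ) : Equivalence (Conn U D) where
  refl a := ⟨rfl, fun x h1 h2 => by omega⟩
  symm := fun ⟨h1, h2⟩ => ⟨h1.symm, fun x h3 h4 => h1 ▸ h2 x h3.symm h4.symm⟩
  trans := by
    rintro a b c ⟨h1, h2⟩ ⟨h3, h4⟩
    refine ⟨h1.trans h3, fun x h5 h6 => ?_⟩
    by_cases h : (a ≤ x ∨ b ≤ x) ∧ (x < a ∨ x < b)
    · exact h2 x h.1 h.2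
    · rw [h1]
      exact h4 x (by omega) (by omega)

/-- The hypothesis `h0` is the ballot condition in its strict form (the closer at `x` is matched by
an opener before `x`), so all mid-heights are nonnegative; `hN` says that the height is eventually
`0`. -/
theorem conn_isNC {U D : Set ℕ} (h0 : ∀ x, countBelow D (x + 1) ≤ countBelow U x)
    (hN : ∃ N, ∀ n, N ≤ n → countBelow U n = countBelow D n) : IsNC id (Conn U D) U D where
  equiv := conn_equivalence U D
  noncrossing := by
    rintro a b c d hab hbc hcd ⟨h1, h2⟩ ⟨h3, h4⟩
    simp only [id] at hab hbc hcd
    have e1 := h2 b (by omega) (by omega)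
    have e2 := h4 c (by omega) (by omega)
    have e3 := midHeight_le_gapHeight U D b
    have e4 := midHeight_le_gapHeight U D c
    -- The gap after `b` is above the level of `a`, so `b` is at least as high as `a`; likewise `c`
    -- is at least as high as `b`. Since `a` and `c` have equal height, so does `b`.
    exact ⟨by omega, fun x h5 h6 => h2 x (by omega) (by omega)⟩
  mem_left := by
    intro x
    simp only [id]
    constructor
    · intro hx
      obtain ⟨N, hN⟩ := hN
      have hm : 0 ≤ midHeight U D x := by
        have := h0 x
        simp only [midHeight]
        omega
      have hex : ∃ k, x < k ∧ midHeight U D k ≤ midHeight U D x := by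
        refine ⟨x + 1 + N, by omega, ?_⟩
        have h1 := (midHeight_le_gapHeight U D (x + 1 + N)).1
        have h2 : gapHeight U D (x + 1 + N) = 0 := by
          simp only [gapHeight]
          rw [hN _ (by omega)]
          omega
        omega
      -- The partner of `x` is the first later position whose height does not exceed that of `x`;
      -- unit steps force equality there.
      obtain ⟨k, ⟨h1, h2⟩, h3⟩ := exists_minimal_value id hex
      have hg : ∀ y, x ≤ y → y < k → midHeight U D x < gapHeight U D y := by
        intro y hy1 hy2
        rcases hy1.eq_or_lt with rfl | hy1
        · have := (midHeight_facts U D x).1 hx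
          omega
        · have e1 : midHeight U D x < midHeight U D y := by
            by_contra e
            have := h3 y ⟨hy1, by omega⟩
            simp only [id] at this
            omega
          have := midHeight_le_gapHeight U D y
          omega
      refine ⟨k, h1, ?_, fun y hy1 hy2 => hg y (by omega) (by omega)⟩
      obtain ⟨k, rfl⟩ : ∃ l, k = l + 1 := ⟨k - 1, by omega⟩
      have e1 := hg k (by omega) (by omega)
      have e2 := midHeight_le_gapHeight U D k
      omega
    · rintro ⟨k, h1, h2, h3⟩
      by_contra hx
      have := h3 x (by omega) (by omega)
      have := (midHeight_facts U D x).2.1 hx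
      omega
  mem_right := by
    intro x
    simp only [id]
    constructor
    · intro hx
      have hx0 : x ≠ 0 := by
        rintro rfl
        have h1 := h0 0
        rw [countBelow_succ_of_mem hx, countBelow_zero U] at h1
        omega
      have hm : 0 ≤ midHeight U D x := by
        have := h0 x
        simp only [midHeight]
        omega
      have hex : ∃ k, k < x ∧ midHeight U D k ≤ midHeight U D x := by
        refine ⟨0, by omega, ?_⟩
        have : midHeight U D 0 ≤ 0 := by
          simp only [midHeight, countBelow_zero]
          omega
        omega
      -- Minimizing `x - k` picks the last such position before `x`.
      obtain ⟨k, ⟨h1, h2⟩, h3⟩ := exists_minimal_value (fun k => x - k) hex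
      have hmid : ∀ y, k < y → y < x → midHeight U D x < midHeight U D y := by
        intro y hy1 hy2
        by_contra e
        have := h3 y ⟨hy2, by omega⟩
        omega
      have hg : ∀ y, k ≤ y → y < x → midHeight U D x < gapHeight U D y := by
        intro y hy1 hy2
        by_cases hy : y + 1 = x
        · have := (midHeight_facts U D y).2.2.1 (by rwa [hy])
          rw [hy] at this
          omega
        · have := hmid (y + 1) (by omega) (by omega)
          have := midHeight_le_gapHeight U D y
          omega
      have e1 := hg k le_rfl h1
      have e2 := midHeight_le_gapHeight U D k
      have e3 : midHeight U D k = midHeight U D x := by omega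
      exact ⟨k, h1, e3, fun y hy1 hy2 => e3 ▸ hg y (by omega) (by omega)⟩
    · rintro ⟨k, h1, h2, h3⟩
      by_contra hx
      obtain ⟨x, rfl⟩ : ∃ l, x = l + 1 := ⟨x - 1, by omega⟩
      have := h3 x (by omega) (by omega)
      have := (midHeight_facts U D x).2.2.2 hx
      omega

/-- If `m` openers lie below `x` but more than `m` closers lie at or below `x`, then column `m` has
`d m ≤ x ≤ u m`. -/
theorem countBelow_succ_le {c : ℕ} {u d : Fin c → ℕ} (hu : StrictMono u) (hd : StrictMono d)
    (h : ∀ j, u j < d j) (x : ℕ) :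
    countBelow (Set.range d) (x + 1) ≤ countBelow (Set.range u) x := by
  by_contra hlt
  have h1 := countBelow_range_le hd (x + 1)
  have h2 := lt_countBelow_range hd (x + 1) ⟨countBelow (Set.range u) x, by omega⟩
  have h3 := lt_countBelow_range hu x ⟨countBelow (Set.range u) x, by omega⟩
  have h4 := h ⟨countBelow (Set.range u) x, by omega⟩
  simp only [lt_irrefl, false_iff] at h2 h3
  omega

theorem countBelow_range_eq {c : ℕ} {u : Fin c → ℕ} (hu : StrictMono u) {n : ℕ}
    (h : ∀ j, u j < n) : countBelow (Set.range u) n = c := by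
  refine le_antisymm (countBelow_range_le hu n) ?_
  by_contra hlt
  have := (lt_countBelow_range hu n ⟨_, not_le.1 hlt⟩).2 (h _)
  simp at this

/-- The rows of a two-row increasing tableau are the openers and closers of a noncrossing
equivalence relation. -/
theorem isNC_of_rows {α : Type*} {ρ : α → ℕ} (hρ : Function.Injective ρ) {c : ℕ}
    {u d : Fin c → α} (hu : StrictMono (ρ ∘ u)) (hd : StrictMono (ρ ∘ d))
    (h : ∀ j, ρ (u j) < ρ (d j)) :
    IsNC ρ (fun x y => Conn (Set.range (ρ ∘ u)) (Set.range (ρ ∘ d)) (ρ x) (ρ y))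
      (Set.range u) (Set.range d) := by
  refine IsNC.comap hρ ?_
  rw [← Set.range_comp, ← Set.range_comp]
  refine conn_isNC (countBelow_succ_le hu hd h) ?_
  obtain ⟨N, hN⟩ := (Set.finite_range (ρ ∘ d)).bddAbove
  have hd' : ∀ j, ρ (d j) ≤ N := fun j => hN ⟨j, rfl⟩
  refine ⟨N + 1, fun n hn => ?_⟩
  rw [countBelow_range_eq hu, countBelow_range_eq hd]
  · intro j; have := hd' j; simp only [Function.comp]; omega
  · intro j; have := hd' j; have := h j; simp only [Function.comp]; omega


/-! ## Tracking K-gromotion -/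

section Slides

variable {α β : Type*} {r c : ℕ}

theorem slide_of_fill {x : α} {S : Fin r × Fin c → Option α} {b : Fin r × Fin c}
    (h : S b = none) (h' : ∃ b', BoxAdj b b' ∧ S b' = some x) : slide x S b = some x :=
  if_pos ⟨h, h'⟩

theorem slide_of_leave {x : α} {S : Fin r × Fin c → Option α} {b : Fin r × Fin c}
    (h : S b = some x) (h' : ∃ b', BoxAdj b b' ∧ S b' = none) : slide x S b = none :=
  (if_neg fun hn => by simp [h] at hn).trans (if_pos ⟨h, h'⟩)

theorem slide_of_stay {x : α} {S : Fin r × Fin c → Option α} {b : Fin r × Fin c}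
    (h1 : S b = none → ∀ b', BoxAdj b b' → S b' ≠ some x)
    (h2 : S b = some x → ∀ b', BoxAdj b b' → S b' ≠ none) : slide x S b = S b :=
  (if_neg fun ⟨h, b', hb, h'⟩ => h1 h b' hb h').trans
    (if_neg fun ⟨h, b', hb, h'⟩ => h2 h b' hb h')

/-- Sliding only tests letters for equality, so it commutes with injective relabelling. This allows
letters to be replaced by their ranks. -/
theorem slide_map {ρ : α → β} (hρ : Function.Injective ρ) (x : α)
    (S : Fin r × Fin c → Option α) :
    (fun b => (slide x S b).map ρ) = slide (ρ x) fun b => (S b).map ρ := by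
  funext b
  have h1 : ∀ b, (S b).map ρ = some (ρ x) ↔ S b = some x := by
    intro b
    rw [← Option.map_some, (Option.map_injective hρ).eq_iff]
  have h2 : ∀ b, (S b).map ρ = none ↔ S b = none := fun b => Option.map_eq_none_iff
  by_cases hf : S b = none ∧ ∃ b', BoxAdj b b' ∧ S b' = some x
  · obtain ⟨hb, b', hadj, hb'⟩ := hf
    rw [slide_of_fill hb ⟨b', hadj, hb'⟩]
    exact (slide_of_fill ((h2 b).2 hb) ⟨b', hadj, (h1 b').2 hb'⟩).symm
  by_cases hl : S b = some x ∧ ∃ b', BoxAdj b b' ∧ S b' = none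
  · obtain ⟨hb, b', hadj, hb'⟩ := hl
    rw [slide_of_leave hb ⟨b', hadj, hb'⟩]
    exact (slide_of_leave ((h1 b).2 hb) ⟨b', hadj, (h2 b').2 hb'⟩).symm
  rw [slide_of_stay (fun h b' hb hb' => hf ⟨h, b', hb, hb'⟩)
    fun h b' hb hb' => hl ⟨h, b', hb, hb'⟩]
  exact (slide_of_stay (fun h b' hb hb' => hf ⟨(h2 b).1 h, b', hb, (h1 b').1 hb'⟩)
    fun h b' hb hb' => hl ⟨(h1 b).1 h, b', hb, (h2 b').1 hb'⟩).symm

theorem slides_append_singleton (a x : α) (L : List α) (T : Fin r × Fin c → α) :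
    slides a (L ++ [x]) T = slide x (slides a L T) := by
  simp [slides]

theorem slides_map {ρ : α → β} (hρ : Function.Injective ρ) (a : α) (L : List α)
    (T : Fin r × Fin c → α) :
    (fun b => (slides a L T b).map ρ) = slides (ρ a) (L.map ρ) (ρ ∘ T) := by
  induction L using List.reverseRecOn with
  | nil =>
    funext b
    simp only [slides, List.map_nil, List.foldl_nil, deleteEntry, Function.comp_apply]
    by_cases h : T b = a
    · rw [if_pos h, if_pos (congrArg ρ h), Option.map_none]
    · rw [if_neg h, if_neg fun h' => h (hρ h'), Option.map_some]
  | append_singleton L x ih =>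
    rw [List.map_append, List.map_singleton, slides_append_singleton, slides_append_singleton,
      slide_map hρ, ih]

theorem slides_of_notMem {a : α} {T : Fin r × Fin c → α} (h : ∀ b, T b ≠ a) (L : List α) :
    slides a L T = fun b => some (T b) := by
  induction L using List.reverseRecOn with
  | nil =>
    funext b
    exact if_neg (h b)
  | append_singleton L x ih =>
    rw [slides_append_singleton, ih]
    funext b
    exact slide_of_stay (fun h => by simp at h) fun _ _ _ => by simp

theorem gromote_of_notMem {a : α} {T : Fin r × Fin c → α} (h : ∀ b, T b ≠ a) (L : List α) :
    gromote (a :: L) T = T := by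
  funext b
  simp [gromote, slides_of_notMem h]

theorem not_movesUp_of_notMem {a : α} {T : Fin r × Fin c → α} (h : ∀ b, T b ≠ a) (L : List α)
    (i : ℕ) (β : α) :
    ¬ MovesUp (a :: L) T i β := by
  rintro ⟨a', L₁, L₂, hA, b, b', -, -, -, hb, -⟩
  obtain ⟨rfl, -⟩ := List.cons.inj hA
  rw [slides_of_notMem h] at hb
  simp at hb

/-- The state at time `n` when the box `b` has its entry `f b` replaced by `•` at time `f b`,
which in turn is replaced by `g b` at time `g b`. -/
def stateAt (f g : Fin r × Fin c → ℕ) (n : ℕ) : Fin r × Fin c → Option ℕ := fun b =>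
  if n ≤ f b then some (f b) else if n ≤ g b then none else some (g b)

theorem stateAt_eq_none {f g : Fin r × Fin c → ℕ} {n : ℕ} {b : Fin r × Fin c} :
    stateAt f g n b = none ↔ f b < n ∧ n ≤ g b := by
  unfold stateAt
  split_ifs <;> simp <;> omega

theorem stateAt_eq_some {f g : Fin r × Fin c → ℕ} (hfg : ∀ b, f b ≤ g b) {n : ℕ}
    {b : Fin r × Fin c} : stateAt f g n b = some n ↔ f b = n := by
  have := hfg b
  unfold stateAt
  split_ifs <;> simp <;> omega

/-- The conditions under which `stateAt f g` follows the rules of K-gromotion at time `n`. -/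
structure Tracks (f g : Fin r × Fin c → ℕ) (n : ℕ) : Prop where
  le : ∀ b, f b ≤ g b
  leave : ∀ b, f b = n → n < g b → ∃ b', BoxAdj b b' ∧ f b' < n ∧ n ≤ g b'
  stay : ∀ b b', f b = n → g b = n → BoxAdj b b' → ¬ (f b' < n ∧ n ≤ g b')
  fill : ∀ b, f b < n → g b = n → ∃ b', BoxAdj b b' ∧ f b' = n
  wait : ∀ b b', f b < n → n < g b → BoxAdj b b' → f b' ≠ n

theorem Tracks.slide_eq {f g : Fin r × Fin c → ℕ} {n : ℕ} (h : Tracks f g n) :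
    slide n (stateAt f g n) = stateAt f g (n + 1) := by
  funext b
  have hle := h.le b
  by_cases h1 : f b < n ∧ n = g b
  · obtain ⟨b', hb, hb'⟩ := h.fill b h1.1 h1.2.symm
    rw [slide_of_fill (stateAt_eq_none.2 (by omega)) ⟨b', hb, (stateAt_eq_some h.le).2 hb'⟩]
    unfold stateAt
    rw [if_neg (by omega), if_neg (by omega), h1.2]
  by_cases h2 : f b = n ∧ n < g b
  · obtain ⟨b', hb, hb'⟩ := h.leave b h2.1 h2.2
    rw [slide_of_leave ((stateAt_eq_some h.le).2 h2.1) ⟨b', hb, stateAt_eq_none.2 hb'⟩]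
    unfold stateAt
    rw [if_neg (by omega), if_pos (by omega)]
  rw [slide_of_stay]
  · unfold stateAt
    split_ifs <;> first | rfl | omega | (congr 1; omega)
  · intro hb b' hadj hb'
    rw [stateAt_eq_none] at hb
    exact h.wait b b' hb.1 (by omega) hadj ((stateAt_eq_some h.le).1 hb')
  · intro hb b' hadj hb'
    rw [stateAt_eq_some h.le] at hb
    exact h.stay b b' hb (by omega) hadj (stateAt_eq_none.1 hb')

/-- Deleting `0` produces the state at time `1`, and the slide for `n` leads from time `n` to time
`n + 1`. A box with `N ≤ g b` that has been emptied is still empty after the last letter. -/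
theorem slides_eq_stateAt {f g : Fin r × Fin c → ℕ} {N : ℕ} (h0 : ∀ b, f b = 0 → 0 < g b)
    (h : ∀ n, 1 ≤ n → n < N → Tracks f g n) (n : ℕ) (hn : n < N) :
    slides 0 (List.range' 1 n) f = stateAt f g (n + 1) := by
  induction n with
  | zero =>
    funext b
    have := h0 b
    simp only [slides, List.range'_zero, List.foldl_nil, deleteEntry, stateAt]
    split_ifs <;> first | rfl | omega
  | succ n ih =>
    rw [List.range'_1_concat, slides_append_singleton, ih (by omega), Nat.add_comm 1 n]
    exact (h (n + 1) (by omega) hn).slide_eq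

end Slides

/-! ## Two rows -/

/-- The entries of a two-row increasing filling, with `u` for the top row and `d` for the bottom
row, both continued arbitrarily beyond column `c` and beyond the alphabet `0, ..., N - 1`. The
entry `0` occurs. Column `e` is the first one with `d j < u (j + 1)`, column `k` the first one with
`d j ≤ u (j + 1)`. -/
structure TwoRows (c N : ℕ) (u d : ℕ → ℕ) (k e : ℕ) : Prop where
  zero : u 0 = 0
  top : StrictMono u
  bot : StrictMono d
  col : ∀ j, u j < d j
  top_lt : ∀ j, u j < N ↔ j < c
  bot_lt : ∀ j, d j < N ↔ j < c
  last_lt : e < c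
  last : d e < u (e + 1)
  before_last : ∀ j, j < e → u (j + 1) ≤ d j
  first_le : k ≤ e
  first : d k ≤ u (k + 1)
  before_first : ∀ j, j < k → u (j + 1) < d j

namespace TwoRows

variable {c N : ℕ} {u d : ℕ → ℕ} {k e : ℕ}

/-- The initial entries. -/
def initial (c : ℕ) (u d : ℕ → ℕ) (b : Fin 2 × Fin c) : ℕ := if b.1 = 0 then u b.2 else d b.2

/-- The final entry of the top row in column `j`. -/
def topOut (u d : ℕ → ℕ) (e j : ℕ) : ℕ :=
  if j < e then u (j + 1) else if j = e then d e else u j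

/-- The final entry of the bottom row in column `j`. -/
def botOut (d : ℕ → ℕ) (k j : ℕ) : ℕ := if j < k then d j else d (j + 1)

/-- The final entries. -/
def final (c : ℕ) (u d : ℕ → ℕ) (k e : ℕ) (b : Fin 2 × Fin c) : ℕ :=
  if b.1 = 0 then topOut u d e b.2 else botOut d k b.2

theorem topOut_facts (h : TwoRows c N u d k e) (j : ℕ) :
    (j < e → topOut u d e j = u (j + 1) ∧ u (j + 1) ≤ d j) ∧
    (j = e → topOut u d e j = d j ∧ d j < u (j + 1)) ∧ (e < j → topOut u d e j = u j) := by
  refine ⟨fun h' => ⟨if_pos h', h.before_last j h'⟩, ?_, fun h' => ?_⟩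
  · rintro rfl
    exact ⟨by simp [topOut], h.last⟩
  · simp only [topOut]
    rw [if_neg (by omega), if_neg (by omega)]

theorem botOut_facts (h : TwoRows c N u d k e) (j : ℕ) :
    (j < k → botOut d k j = d j ∧ u (j + 1) < d j) ∧
    (j = k → botOut d k j = d (j + 1) ∧ d j ≤ u (j + 1)) ∧
    (k < j → botOut d k j = d (j + 1)) := by
  refine ⟨fun h' => ⟨if_pos h', h.before_first j h'⟩, ?_, fun h' => ?_⟩
  · rintro rfl
    exact ⟨by simp [botOut], h.first⟩
  · simp only [botOut]
    rw [if_neg (by omega)]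

theorem entry_facts (h : TwoRows c N u d k e) (j : ℕ) :
    u j < u (j + 1) ∧ d j < d (j + 1) ∧ u j < d j :=
  ⟨h.top (Nat.lt_succ_self j), h.bot (Nat.lt_succ_self j), h.col j⟩

/-- In the top row exactly the columns up to `e` are emptied, each when its left neighbour is a
hole. In the bottom row exactly the columns from `k` on are emptied: column `k` because of the hole
above it, later ones because of the hole to their left. For `k ≤ j < e` the letter filling the top
box in column `j` is `u (j + 1)`, and the box below takes part only if `d j` equals it. -/
theorem tracks (h : TwoRows c N u d k e) {n : ℕ} (hn : 1 ≤ n) (hN : n < N) :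
    Tracks (initial c u d) (final c u d k e) n := by
  have hke := h.first_le
  have h0 := h.zero
  have hec := h.last_lt
  constructor
  · rintro ⟨i, j, hj⟩
    have f1 := h.topOut_facts j
    have f2 := h.botOut_facts j
    have f3 := h.entry_facts j
    fin_cases i <;> simp [initial, final] <;> omega
  · rintro ⟨i, j, hj⟩ h1 h2
    have f1 := h.topOut_facts j
    have f2 := h.botOut_facts j
    have f3 := h.entry_facts j
    fin_cases i <;> simp [initial, final] at h1 h2
    · have hj0 : j ≠ 0 := by rintro rfl; omega
      obtain ⟨j, rfl⟩ : ∃ l, j = l + 1 := ⟨j - 1, by omega⟩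
      have g1 := h.topOut_facts j
      have g3 := h.entry_facts j
      refine ⟨(0, ⟨j, by omega⟩), Or.inl ⟨rfl, Or.inr rfl⟩, ?_⟩
      simp [initial, final]
      omega
    -- The hole above column `k` is still there at time `d k`: either `k = e`, or `k < e` and `d k =
    -- u (k + 1)`.
    · by_cases hjk : j = k
      · refine ⟨(0, ⟨j, by omega⟩), Or.inr ⟨rfl, Or.inr rfl⟩, ?_⟩
        simp [initial, final]
        omega
      · obtain ⟨j, rfl⟩ : ∃ l, j = l + 1 := ⟨j - 1, by omega⟩
        have g1 := h.botOut_facts j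
        have g3 := h.entry_facts j
        refine ⟨(1, ⟨j, by omega⟩), Or.inl ⟨rfl, Or.inr rfl⟩, ?_⟩
        simp [initial, final]
        omega
  · rintro ⟨i, j, hj⟩ ⟨i', j', hj'⟩ h1 h2 hadj
    have f1 := h.topOut_facts j
    have f2 := h.botOut_facts j
    have f3 := h.entry_facts j
    have g1 := h.topOut_facts j'
    have g2 := h.botOut_facts j'
    have g3 := h.entry_facts j'
    fin_cases i <;> fin_cases i' <;> simp [initial, final, BoxAdj] at h1 h2 hadj ⊢
    · rcases hadj with rfl | rfl <;> omega
    · subst hadj; omega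
    · subst hadj; omega
    · rcases hadj with rfl | rfl <;> omega
  · rintro ⟨i, j, hj⟩ h1 h2
    have f1 := h.topOut_facts j
    have f2 := h.botOut_facts j
    have f3 := h.entry_facts j
    have hb := h.bot_lt (j + 1)
    have ht := h.top_lt (j + 1)
    fin_cases i <;> simp [initial, final] at h1 h2
    · by_cases hje : j = e
      · refine ⟨(1, ⟨j, by omega⟩), Or.inr ⟨rfl, Or.inl rfl⟩, ?_⟩
        simp [initial]
        omega
      · refine ⟨(0, ⟨j + 1, by omega⟩), Or.inl ⟨rfl, Or.inl rfl⟩, ?_⟩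
        simp [initial]
        omega
    · refine ⟨(1, ⟨j + 1, by omega⟩), Or.inl ⟨rfl, Or.inl rfl⟩, ?_⟩
      simp [initial]
      omega
  · rintro ⟨i, j, hj⟩ ⟨i', j', hj'⟩ h1 h2 hadj
    have f1 := h.topOut_facts j
    have f2 := h.botOut_facts j
    have f3 := h.entry_facts j
    have g1 := h.topOut_facts j'
    have g2 := h.botOut_facts j'
    have g3 := h.entry_facts j'
    fin_cases i <;> fin_cases i' <;> simp [initial, final, BoxAdj] at h1 h2 hadj ⊢
    · rcases hadj with rfl | rfl <;> omega
    · subst hadj; omega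
    · subst hadj; omega
    · rcases hadj with rfl | rfl <;> omega

theorem slides_eq (h : TwoRows c N u d k e) {n : ℕ} (hn : n < N) :
    slides 0 (List.range' 1 n) (initial c u d) =
      stateAt (initial c u d) (final c u d k e) (n + 1) := by
  refine slides_eq_stateAt ?_ (fun n h1 h2 => h.tracks h1 h2) n hn
  rintro ⟨i, j, hj⟩
  have f1 := h.topOut_facts j
  have f3 := h.entry_facts j
  have h0 := h.zero
  fin_cases i <;> simp [initial, final]
  · intro h1
    have hj0 : j = 0 := by
      by_contra hj0
      have := h.top (Nat.pos_of_ne_zero hj0)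
      omega
    omega
  · omega

theorem topOut_strictMono (h : TwoRows c N u d k e) : StrictMono (topOut u d e) := by
  refine strictMono_nat_of_lt_succ fun j => ?_
  have f1 := h.topOut_facts j
  have f2 := h.topOut_facts (j + 1)
  have f3 := h.entry_facts j
  have f4 := h.entry_facts (j + 1)
  omega

theorem botOut_strictMono (h : TwoRows c N u d k e) : StrictMono (botOut d k) := by
  refine strictMono_nat_of_lt_succ fun j => ?_
  have f1 := h.botOut_facts j
  have f2 := h.botOut_facts (j + 1)
  have f3 := h.entry_facts j
  have f4 := h.entry_facts (j + 1)
  omega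

theorem topOut_lt_botOut (h : TwoRows c N u d k e) (j : ℕ) : topOut u d e j < botOut d k j := by
  have f1 := h.topOut_facts j
  have f2 := h.botOut_facts j
  have f3 := h.entry_facts j
  have := h.first_le
  omega

theorem topOut_lt (h : TwoRows c N u d k e) {j : ℕ} (hj : j < c) : topOut u d e j < N := by
  have f1 := h.topOut_facts j
  have f2 := h.bot_lt j
  have f3 := h.top_lt j
  omega

theorem topOut_pos (h : TwoRows c N u d k e) (j : ℕ) : 0 < topOut u d e j := by
  have f1 := h.topOut_facts j
  have f3 := h.entry_facts j
  rcases Nat.eq_zero_or_pos j with rfl | hj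
  · omega
  · have := h.top hj
    omega

theorem exists_topOut_eq_iff (h : TwoRows c N u d k e) (n : ℕ) :
    (∃ j, j < c ∧ topOut u d e j = n) ↔ (n ≠ 0 ∧ ∃ j, j < c ∧ u j = n) ∨ n = d e := by
  have hec := h.last_lt
  constructor
  · rintro ⟨j, hj, rfl⟩
    have hp := h.topOut_pos j
    have f1 := h.topOut_facts j
    rcases lt_trichotomy j e with h' | h' | h'
    · exact Or.inl ⟨by omega, j + 1, by omega, by omega⟩
    · subst h'
      exact Or.inr (by omega)
    · exact Or.inl ⟨by omega, j, hj, by omega⟩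
  · rintro (⟨hn, j, hj, rfl⟩ | rfl)
    · rcases le_or_gt j e with h' | h'
      · have hj0 : j ≠ 0 := by rintro rfl; exact hn h.zero
        obtain ⟨j, rfl⟩ : ∃ l, j = l + 1 := ⟨j - 1, by omega⟩
        have f1 := h.topOut_facts j
        exact ⟨j, by omega, by omega⟩
      · have f1 := h.topOut_facts j
        exact ⟨j, hj, by omega⟩
    · have f1 := h.topOut_facts e
      exact ⟨e, hec, by omega⟩

theorem exists_botOut_eq_iff (h : TwoRows c N u d k e) {n : ℕ} (hn : n < N) :
    (∃ j, j < c ∧ botOut d k j = n) ↔ n ≠ d k ∧ ∃ j, j < c ∧ d j = n := by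
  constructor
  · rintro ⟨j, hj, rfl⟩
    have f1 := h.botOut_facts j
    have f2 := h.bot_lt (j + 1)
    rcases lt_or_ge j k with h' | h'
    · have := h.bot h'
      exact ⟨by omega, j, hj, by omega⟩
    · have := h.bot (Nat.lt_succ_of_le h')
      simp only [Nat.succ_eq_add_one] at this
      exact ⟨by omega, j + 1, by omega, by omega⟩
  · rintro ⟨h1, j, hj, rfl⟩
    have f1 := h.botOut_facts j
    rcases lt_trichotomy j k with h' | h' | h'
    · exact ⟨j, hj, by omega⟩
    · exact absurd (congrArg d h') h1
    · obtain ⟨j, rfl⟩ : ∃ l, j = l + 1 := ⟨j - 1, by omega⟩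
      have f1 := h.botOut_facts j
      exact ⟨j, by omega, by omega⟩

theorem le_of_first (h : TwoRows c N u d k e) {j : ℕ} (hj : d j ≤ u (j + 1)) : k ≤ j := by
  by_contra h'
  have := h.before_first j (by omega)
  omega

/-- The class of `0` for the matching relation of the two rows. -/
theorem conn_zero_iff (h : TwoRows c N u d k e) {U D : Set ℕ}
    (hU : ∀ j n, n ≤ N → (j < countBelow U n ↔ u j < n))
    (hD : ∀ j n, n ≤ N → (j < countBelow D n ↔ d j < n)) {j : ℕ} (hj : j < c) :
    Conn U D 0 (d j) ↔ j ≤ e ∧ d j ≤ u (j + 1) := by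
  have hdN := (h.bot_lt j).2 hj
  have h0 : midHeight U D 0 = 0 := by
    have h1 := hD 0 (0 + 1) (by omega)
    have h2 := h.col 0
    have h3 := countBelow_zero U
    simp only [midHeight]
    omega
  have hDj : countBelow D (d j + 1) = j + 1 := by
    have h1 := hD j (d j + 1) (by omega)
    have h2 := hD (j + 1) (d j + 1) (by omega)
    have h3 := h.entry_facts j
    omega
  have hUj : countBelow U (d j) = j + 1 ↔ d j ≤ u (j + 1) := by
    have h1 := hU j (d j) (by omega)
    have h2 := hU (j + 1) (d j) (by omega)
    have h3 := h.entry_facts j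
    omega
  have hmid : midHeight U D 0 = midHeight U D (d j) ↔ d j ≤ u (j + 1) := by
    rw [h0, ← hUj]
    simp only [midHeight]
    omega
  rw [Conn, hmid, and_comm]
  refine and_congr_left fun h1 => ?_
  constructor
  · intro h2
    by_contra hje
    -- Right after `d e` at least `e + 1` parentheses have been closed and at most `e + 1` opened,
    -- so the height has dropped to the level of `0`.
    have h3 := h2 (d e) (by omega) (Or.inr (h.bot (by omega)))
    have h4 := hU (e + 1) (d e + 1) (by have := h.bot (by omega : e < j); omega)
    have h5 := hD e (d e + 1) (by have := h.bot (by omega : e < j); omega)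
    have h6 := h.last
    simp only [gapHeight] at h3
    omega
  · intro hje x hx hx'
    rw [h0]
    have h2 := countBelow_mono D (by omega : x + 1 ≤ d j)
    have h3 := hD j (d j) (by omega)
    have h4 := hU (countBelow D (x + 1)) (x + 1) (by omega)
    -- If `i + 1` closers lie at or below `x`, then `u (i + 1) ≤ d i ≤ x` because `i < e`; hence
    -- strictly more openers than closers lie there.
    have h5 : u (countBelow D (x + 1)) < x + 1 := by
      rcases Nat.eq_zero_or_pos (countBelow D (x + 1)) with h5 | h5
      · rw [h5, h.zero]; omega
      · obtain ⟨i, hi⟩ : ∃ i, countBelow D (x + 1) = i + 1 := ⟨countBelow D (x + 1) - 1, by omega⟩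
        have h6 := hD i (x + 1) (by omega)
        have h7 := h.before_last i (by omega)
        rw [hi]
        omega
    simp only [gapHeight]
    omega

end TwoRows

/-! ## The ordered alphabet -/

section Alphabet

variable {α : Type*} [DecidableEq α] {c : ℕ}

/-- The filling `T` is increasing for the ordered alphabet `A`, and the noncrossing relation `r`
is associated with it. -/
structure Adapted (r : α → α → Prop) (A : List α) (T : Fin 2 × Fin c → α) : Prop where
  nodup : A.Nodup
  mem : ∀ x, x ∈ A
  row : ∀ i, StrictMono fun j => A.idxOf (T (i, j))
  col : ∀ j, A.idxOf (T (0, j)) < A.idxOf (T (1, j))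
  isNC : IsNC (fun x => A.idxOf x) r (Set.range fun j => T (0, j)) (Set.range fun j => T (1, j))

/-- The ranks of the entries in row `i`, continued beyond column `c`. -/
def rowRank (A : List α) (T : Fin 2 × Fin c → α) (i : Fin 2) (j : ℕ) : ℕ :=
  if h : j < c then A.idxOf (T (i, ⟨j, h⟩)) else A.length + j + i

theorem rowRank_of_lt (A : List α) (T : Fin 2 × Fin c → α) (i : Fin 2) {j : ℕ} (h : j < c) :
    rowRank A T i j = A.idxOf (T (i, ⟨j, h⟩)) := dif_pos h

theorem rowRank_of_ge (A : List α) (T : Fin 2 × Fin c → α) (i : Fin 2) {j : ℕ} (h : c ≤ j) :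
    rowRank A T i j = A.length + j + i := dif_neg (not_lt.2 h)

theorem initial_rowRank (A : List α) (T : Fin 2 × Fin c → α) :
    TwoRows.initial c (rowRank A T 0) (rowRank A T 1) = (fun x => A.idxOf x) ∘ T := by
  funext ⟨i, j, hj⟩
  fin_cases i <;> simp [TwoRows.initial, rowRank_of_lt, hj]

namespace Adapted

variable {r : α → α → Prop} {A : List α} {T : Fin 2 × Fin c → α}

theorem idxOf_injective (h : Adapted r A T) : Function.Injective fun x => A.idxOf x :=
  fun x _ hxy => (List.idxOf_inj (h.mem x)).1 hxy

theorem idxOf_lt (h : Adapted r A T) (x : α) : A.idxOf x < A.length :=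
  List.idxOf_lt_length_of_mem (h.mem x)

theorem rowRank_lt_iff (h : Adapted r A T) (i : Fin 2) (j : ℕ) :
    rowRank A T i j < A.length ↔ j < c := by
  by_cases hj : j < c
  · simp only [rowRank_of_lt A T i hj, hj, iff_true]
    exact h.idxOf_lt _
  · rw [rowRank_of_ge A T i (by omega)]
    omega

theorem rowRank_strictMono (h : Adapted r A T) (i : Fin 2) : StrictMono (rowRank A T i) := by
  refine strictMono_nat_of_lt_succ fun j => ?_
  by_cases hj : j + 1 < c
  · rw [rowRank_of_lt A T i hj, rowRank_of_lt A T i (by omega)]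
    exact h.row i (Fin.mk_lt_mk.2 (Nat.lt_succ_self j))
  · have h1 := h.rowRank_lt_iff i j
    rw [rowRank_of_ge A T i (by omega : c ≤ j + 1)]
    by_cases hj : j < c
    · omega
    · rw [rowRank_of_ge A T i (by omega : c ≤ j)]
      omega

/-- The padding `A.length + j + i` keeps rows and columns strict while leaving the alphabet. Thus
column `c - 1` satisfies `d j < u (j + 1)`, so `e` exists and is less than `c`. -/
theorem exists_twoRows (h : Adapted r A T) {b : Fin 2 × Fin c} (hb : A.idxOf (T b) = 0) :
    ∃ k e, TwoRows c A.length (rowRank A T 0) (rowRank A T 1) k e := by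
  have hcol : ∀ j, rowRank A T 0 j < rowRank A T 1 j := by
    intro j
    by_cases hj : j < c
    · rw [rowRank_of_lt A T 0 hj, rowRank_of_lt A T 1 hj]
      exact h.col _
    · rw [rowRank_of_ge A T 0 (by omega), rowRank_of_ge A T 1 (by omega)]
      simp
  have h0 : rowRank A T 0 0 = 0 := by
    obtain ⟨i, j, hj⟩ := b
    have h1 := (h.rowRank_strictMono i).monotone (Nat.zero_le j)
    have h2 := hcol 0
    rw [rowRank_of_lt A T i hj, hb] at h1
    fin_cases i <;> simp at h1 <;> omega
  have hc : 0 < c := (Nat.zero_le _).trans_lt b.2.2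
  have hex : ∃ j, rowRank A T 1 j < rowRank A T 0 (j + 1) := by
    refine ⟨c - 1, ?_⟩
    have h1 := h.rowRank_lt_iff 1 (c - 1)
    have h2 := h.rowRank_lt_iff 0 (c - 1 + 1)
    omega
  have hex' : ∃ j, rowRank A T 1 j ≤ rowRank A T 0 (j + 1) := hex.imp fun _ => le_of_lt
  refine ⟨Nat.find hex', Nat.find hex, h0, h.rowRank_strictMono 0, h.rowRank_strictMono 1, hcol,
    h.rowRank_lt_iff 0, h.rowRank_lt_iff 1, ?_, Nat.find_spec hex,
    fun j hj => not_lt.1 (Nat.find_min hex hj), ?_, Nat.find_spec hex',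
    fun j hj => not_le.1 (Nat.find_min hex' hj)⟩
  · refine (Nat.find_min' hex (m := c - 1) ?_).trans_lt (by omega)
    have h1 := h.rowRank_lt_iff 1 (c - 1)
    have h2 := h.rowRank_lt_iff 0 (c - 1 + 1)
    omega
  · exact Nat.find_min' hex' (Nat.find_spec hex).le

theorem mem_row_iff (h : Adapted r A T) (i : Fin 2) (x : α) :
    x ∈ Set.range (fun j => T (i, j)) ↔ ∃ j, j < c ∧ rowRank A T i j = A.idxOf x := by
  constructor
  · rintro ⟨⟨j, hj⟩, rfl⟩
    exact ⟨j, hj, rowRank_of_lt A T i hj⟩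
  · rintro ⟨j, hj, hx⟩
    rw [rowRank_of_lt A T i hj] at hx
    exact ⟨⟨j, hj⟩, h.idxOf_injective hx⟩

theorem lt_countBelow_row (h : Adapted r A T) (i : Fin 2) (j n : ℕ) (hn : n ≤ A.length) :
    j < countBelow (Set.range ((fun x => A.idxOf x) ∘ fun j => T (i, j))) n ↔
      rowRank A T i j < n := by
  by_cases hj : j < c
  · rw [rowRank_of_lt A T i hj]
    exact lt_countBelow_range (u := (fun x => A.idxOf x) ∘ fun j => T (i, j)) (h.row i) n ⟨j, hj⟩
  · have h1 := countBelow_range_le (u := (fun x => A.idxOf x) ∘ fun j => T (i, j)) (h.row i) n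
    have h2 := h.rowRank_lt_iff i j
    omega

/-- The class of the first letter, if it occurs. -/
theorem rel_first_iff (h : Adapted r A T) {k e : ℕ}
    (ht : TwoRows c A.length (rowRank A T 0) (rowRank A T 1) k e) {a : α} (ha : A.idxOf a = 0)
    (x : α) : r a x ∧ x ≠ a ↔
      ∃ j, j ≤ e ∧ rowRank A T 1 j ≤ rowRank A T 0 (j + 1) ∧ rowRank A T 1 j = A.idxOf x := by
  have hnc := isNC_of_rows h.idxOf_injective (u := fun j => T (0, j)) (d := fun j => T (1, j))
    (h.row 0) (h.row 1) h.col
  -- Uniqueness replaces the abstract `r` by the height description, for which the class of rank `0`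
  -- is known.
  have hiff := h.isNC.unique h.idxOf_injective hnc (x := a) (y := x)
  simp only [ha] at hiff
  have hc := fun {j} => ht.conn_zero_iff (h.lt_countBelow_row 0) (h.lt_countBelow_row 1) (j := j)
  constructor
  · rintro ⟨h1, h2⟩
    have h3 : A.idxOf a < A.idxOf x := by
      rw [ha]
      exact Nat.pos_of_ne_zero fun h' => h2 (h.idxOf_injective (h'.trans ha.symm))
    obtain ⟨j, hj, hx⟩ := (h.mem_row_iff 1 x).1 ((h.isNC.mem_right x).2 ⟨a, h3, h1⟩)
    rw [hiff, ← hx, hc hj] at h1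
    exact ⟨j, h1.1, h1.2, hx⟩
  · rintro ⟨j, h1, h2, h3⟩
    have hj := h1.trans_lt ht.last_lt
    refine ⟨?_, ?_⟩
    · rw [hiff, ← h3, hc hj]
      exact ⟨h1, h2⟩
    · rintro rfl
      have := ht.col j
      omega

end Adapted

end Alphabet

/-! ### One K-gromotion in terms of letters and ranks -/

section Alphabet

variable {α : Type*} [DecidableEq α] {c : ℕ}

theorem map_idxOf_of_nodup {a : α} {L₁ L₂ : List α} (h : (a :: (L₁ ++ L₂)).Nodup) :
    L₁.map (fun x => (a :: (L₁ ++ L₂)).idxOf x) = List.range' 1 L₁.length := by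
  refine List.ext_getElem (by simp) fun i h1 h2 => ?_
  rw [List.length_map] at h1
  have h3 : L₁[i] = (a :: (L₁ ++ L₂))[i + 1]'(by simp; omega) := by
    simp [List.getElem_append_left h1]
  rw [List.getElem_map, h3, h.idxOf_getElem, List.getElem_range']
  omega

theorem idxOf_of_nodup {a b : α} {L₁ L₂ : List α} (h : (a :: (L₁ ++ b :: L₂)).Nodup) :
    (a :: (L₁ ++ b :: L₂)).idxOf b = L₁.length + 1 := by
  simpa using h.idxOf_getElem (L₁.length + 1) (by simp)

/-- Rotation lowers every rank by one, except that `a` goes from `0` to the top; adding `1` avoids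
truncated subtraction. -/
theorem idxOf_rotate {a : α} {L : List α} (h : (a :: L).Nodup) {x : α} (hx : x ∈ a :: L) :
    (L ++ [a]).idxOf x + 1 = if x = a then (a :: L).length else (a :: L).idxOf x := by
  rw [List.nodup_cons] at h
  split_ifs with hxa
  · subst hxa
    rw [List.idxOf_append_of_notMem h.1]
    simp
  · have hx : x ∈ L := by simpa [hxa] using hx
    rw [List.idxOf_append_of_mem hx, List.idxOf_cons_ne _ (Ne.symm hxa)]

namespace Adapted

variable {r : α → α → Prop} {a : α} {L : List α} {T : Fin 2 × Fin c → α}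

theorem idxOf_rotate_lt_iff (h : Adapted r (a :: L) T) (x y : α) :
    (L ++ [a]).idxOf x < (L ++ [a]).idxOf y ↔
      x ≠ a ∧ (y = a ∨ (a :: L).idxOf x < (a :: L).idxOf y) := by
  have h1 := idxOf_rotate h.nodup (h.mem x)
  have h2 := idxOf_rotate h.nodup (h.mem y)
  have h3 := h.idxOf_lt x
  have h4 := h.idxOf_lt y
  by_cases hx : x = a <;> by_cases hy : y = a <;>
    simp only [hx, hy, if_true, if_false, ne_eq, not_true_eq_false, not_false_eq_true, true_or,
      false_or, true_and, false_and, iff_true, iff_false] at h1 h2 h3 h4 ⊢ <;> omega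

theorem idxOf_eq_zero_iff (x : α) : (a :: L).idxOf x = 0 ↔ x = a := by
  by_cases h : a = x
  · simp [h]
  · simp [List.idxOf_cons_ne _ h, Ne.symm h]

/-- Noncrossing relations stay noncrossing when the first letter becomes the last one. -/
theorem noncrossing_rotate (h : Adapted r (a :: L) T) (w x y z : α)
    (h1 : (L ++ [a]).idxOf w < (L ++ [a]).idxOf x) (h2 : (L ++ [a]).idxOf x < (L ++ [a]).idxOf y)
    (h3 : (L ++ [a]).idxOf y < (L ++ [a]).idxOf z) (h4 : r w y) (h5 : r x z) : r w x := by
  rw [h.idxOf_rotate_lt_iff] at h1 h2 h3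
  have hr := h.isNC
  have e1 := h1.2.resolve_left h2.1
  have e2 := h2.2.resolve_left h3.1
  -- Only the last of the four letters can be `a`. In the old order it comes first, and the crossing
  -- becomes one of `z, x` with `w, y`.
  by_cases hz : z = a
  · subst hz
    have e3 : (z :: L).idxOf w ≠ 0 := by rw [Ne, idxOf_eq_zero_iff]; exact h1.1
    have e4 : (z :: L).idxOf z = 0 := by rw [idxOf_eq_zero_iff]
    have := hr.noncrossing z w x y (by omega) e1 e2 (hr.equiv.symm h5) h4
    exact hr.equiv.symm (hr.equiv.trans h5 this)
  · exact hr.noncrossing w x y z e1 e2 (h3.2.resolve_left hz) h4 h5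

theorem slides_map_idxOf (h : Adapted r (a :: L) T) {L₁ L₂ : List α} (hL : L = L₁ ++ L₂) {k e : ℕ}
    (ht : TwoRows c (a :: L).length (rowRank (a :: L) T 0) (rowRank (a :: L) T 1) k e)
    (b : Fin 2 × Fin c) :
    (slides a L₁ T b).map (fun x => (a :: L).idxOf x) =
      stateAt (TwoRows.initial c (rowRank (a :: L) T 0) (rowRank (a :: L) T 1))
        (TwoRows.final c (rowRank (a :: L) T 0) (rowRank (a :: L) T 1) k e) (L₁.length + 1) b := by
  rw [← ht.slides_eq (by simp [hL]), congrFun (slides_map h.idxOf_injective a L₁ T) b,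
    initial_rowRank, List.idxOf_cons_self]
  subst hL
  rw [map_idxOf_of_nodup h.nodup]

/-- The minimum covers the boxes that are still holes at the end: their final value is at least the
length of the alphabet, and they receive `a`, whose new rank is that length minus one. -/
theorem idxOf_gromote (h : Adapted r (a :: L) T) {k e : ℕ}
    (ht : TwoRows c (a :: L).length (rowRank (a :: L) T 0) (rowRank (a :: L) T 1) k e)
    (b : Fin 2 × Fin c) :
    (L ++ [a]).idxOf (gromote (a :: L) T b) + 1 = min (a :: L).length
      (TwoRows.final c (rowRank (a :: L) T 0) (rowRank (a :: L) T 1) k e b) := by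
  have h1 := h.slides_map_idxOf (L₁ := L) (L₂ := []) (by simp) ht b
  have h2 : TwoRows.initial c (rowRank (a :: L) T 0) (rowRank (a :: L) T 1) b <
      (a :: L).length := by
    rw [initial_rowRank]
    exact h.idxOf_lt _
  have h3 : 0 < TwoRows.final c (rowRank (a :: L) T 0) (rowRank (a :: L) T 1) k e b := by
    have h5 := ht.topOut_pos b.2
    have h6 := ht.topOut_lt_botOut b.2
    unfold TwoRows.final
    split_ifs <;> omega
  rw [show gromote (a :: L) T b = (slides a L T b).getD a from rfl,
    idxOf_rotate h.nodup (h.mem _)]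
  rw [List.length_cons] at h2 ⊢
  rw [stateAt, if_neg (by omega)] at h1
  by_cases h4 : L.length + 1 ≤
      TwoRows.final c (rowRank (a :: L) T 0) (rowRank (a :: L) T 1) k e b
  · rw [if_pos h4, Option.map_eq_none_iff] at h1
    rw [h1, Option.getD_none, if_pos rfl]
    omega
  · rw [if_neg h4, Option.map_eq_some_iff] at h1
    obtain ⟨x, hs, h1⟩ := h1
    have hx : x ≠ a := fun hx => by
      have := (idxOf_eq_zero_iff (L := L) x).2 hx
      omega
    rw [hs, Option.getD_some, if_neg hx, h1]
    omega

/-- If `a` does not occur, nothing moves and `a` is alone in its class, since otherwise it would be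
an opener. If it occurs, the letter `d j` moves up exactly when it is the final entry of the top box
in column `j` and its own box is vacated, which is the description of the class of `a` in
`rel_first_iff`. -/
theorem movesUp_iff (h : Adapted r (a :: L) T) (β : α) :
    MovesUp (a :: L) T 1 β ↔ r a β ∧ β ≠ a := by
  by_cases hb : ∀ b, T b ≠ a
  · refine iff_of_false (not_movesUp_of_notMem hb L 1 β) ?_
    rintro ⟨h1, h2⟩
    obtain ⟨j, hj⟩ := (h.isNC.mem_left a).2 ⟨β, by
      simp only [List.idxOf_cons_self]
      exact Nat.pos_of_ne_zero fun h' => h2 ((idxOf_eq_zero_iff β).1 h'), h1⟩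
    exact hb _ hj
  push Not at hb
  obtain ⟨b, hb⟩ := hb
  obtain ⟨k, e, ht⟩ := h.exists_twoRows (b := b) (by rw [hb, List.idxOf_cons_self])
  rw [h.rel_first_iff ht List.idxOf_cons_self]
  have key : ∀ L₁ L₂, L = L₁ ++ β :: L₂ → ∀ j : Fin c,
      (slides a L₁ T (0, j) = none ∧ slide β (slides a L₁ T) (0, j) = some β ∧
        slides a L₁ T (1, j) = some β ∧ slide β (slides a L₁ T) (1, j) = none ↔
      j.val ≤ e ∧ rowRank (a :: L) T 1 j ≤ rowRank (a :: L) T 0 (j + 1) ∧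
        rowRank (a :: L) T 1 j = (a :: L).idxOf β) := by
    intro L₁ L₂ hL j
    have hβ : (a :: L).idxOf β = L₁.length + 1 := by
      subst hL
      exact idxOf_of_nodup h.nodup
    have s1 := h.slides_map_idxOf hL ht
    have s2 := h.slides_map_idxOf (L₁ := L₁ ++ [β]) (L₂ := L₂) (by simp [hL]) ht
    rw [slides_append_singleton] at s2
    have hN : L₁.length + 1 < (a :: L).length := by rw [← hβ]; exact h.idxOf_lt β
    have hle := (ht.tracks (n := 1) le_rfl (by omega)).le
    have hnone : ∀ s : Option α, s = none ↔ s.map (fun x => (a :: L).idxOf x) = none :=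
      fun s => Option.map_eq_none_iff.symm
    have hsome : ∀ s : Option α,
        s = some β ↔ s.map (fun x => (a :: L).idxOf x) = some (L₁.length + 1) := by
      intro s
      rw [← hβ, ← Option.map_some (f := fun x => (a :: L).idxOf x),
        (Option.map_injective h.idxOf_injective).eq_iff]
    rw [hnone, hsome, hsome, hnone, s1, s2, s1, s2, stateAt_eq_some hle, stateAt_eq_none,
      stateAt_eq_none, hβ, List.length_append, List.length_singleton]
    have f1 := ht.topOut_facts j
    have f2 := ht.botOut_facts j
    have f3 := ht.entry_facts j
    -- Just after the slide for rank `n`, a box can hold `n` only as its final entry.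
    have f4 : stateAt (TwoRows.initial c (rowRank (a :: L) T 0) (rowRank (a :: L) T 1))
        (TwoRows.final c (rowRank (a :: L) T 0) (rowRank (a :: L) T 1) k e)
        (L₁.length + 1 + 1) (0, j) = some (L₁.length + 1) ↔
        TwoRows.topOut (rowRank (a :: L) T 0) (rowRank (a :: L) T 1) e j = L₁.length + 1 := by
      have hke := ht.first_le
      simp only [stateAt, TwoRows.initial, TwoRows.final, if_true]
      split_ifs <;> simp <;> omega
    rw [f4]
    simp only [TwoRows.initial, TwoRows.final, if_true, if_neg one_ne_zero]
    have hke := ht.first_le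
    omega
  constructor
  · rintro ⟨a', L₁, L₂, hA, ⟨i, j⟩, ⟨i', j'⟩, h1, h2, h3, h4⟩
    obtain ⟨rfl, hL⟩ := List.cons.inj hA
    obtain rfl : j = j' := h3
    obtain rfl : i = 0 := Fin.ext (by simpa using h1)
    obtain rfl : i' = 1 := Fin.ext h2
    exact ⟨j, (key L₁ L₂ hL j).1 h4⟩
  · rintro ⟨j, h1, h2, h3⟩
    have hj := h1.trans_lt ht.last_lt
    have hβ : β ∈ L := by
      refine (List.mem_cons.1 (h.mem β)).resolve_left fun hβ => ?_
      rw [hβ, List.idxOf_cons_self] at h3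
      have := ht.col j
      omega
    obtain ⟨L₁, L₂, hL⟩ := List.append_of_mem hβ
    exact ⟨a, L₁, L₂, by rw [hL], (0, ⟨j, hj⟩), (1, ⟨j, hj⟩), rfl, rfl, rfl,
      (key L₁ L₂ hL ⟨j, hj⟩).2 ⟨h1, h2, h3⟩⟩

end Adapted

end Alphabet

/-! ### Invariance of the noncrossing relation under K-gromotion -/

namespace Adapted

variable {α : Type*} [DecidableEq α] {c : ℕ} {r : α → α → Prop} {a : α} {A L : List α}
  {T : Fin 2 × Fin c → α}

/-- A letter that does not occur is a singleton class, so moving it to the end of the alphabet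
affects no opener or closer. -/
theorem gromote_cons_of_notMem (h : Adapted r (a :: L) T) (hb : ∀ b, T b ≠ a) :
    Adapted r (L ++ [a]) T := by
  have hidx : ∀ b, (L ++ [a]).idxOf (T b) + 1 = (a :: L).idxOf (T b) := fun b => by
    rw [idxOf_rotate h.nodup (h.mem _), if_neg (hb b)]
  have hr := h.isNC
  have hsing : ∀ x, r a x → x = a := by
    intro x hx
    by_contra hxa
    obtain ⟨j, hj⟩ := (hr.mem_left a).2 ⟨x, by
      rw [List.idxOf_cons_self]
      exact Nat.pos_of_ne_zero fun h' => hxa ((idxOf_eq_zero_iff x).1 h'), hx⟩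
    exact hb _ hj
  have hpos : ∀ {x y}, (a :: L).idxOf x < (a :: L).idxOf y → y ≠ a := by
    rintro x y hxy rfl
    simp at hxy
  refine ⟨?_, ?_, ?_, ?_, hr.equiv, h.noncrossing_rotate, fun x => ?_, fun x => ?_⟩
  · exact (List.perm_append_singleton a L).nodup_iff.2 h.nodup
  · exact fun x => (List.perm_append_singleton a L).mem_iff.2 (h.mem x)
  · intro i j j' hj
    have := h.row i hj
    have h1 := hidx (i, j)
    have h2 := hidx (i, j')
    simp only at this ⊢
    omega
  · intro j
    have := h.col j
    have h1 := hidx (0, j)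
    have h2 := hidx (1, j)
    omega
  · rw [hr.mem_left]
    refine exists_congr fun y => ?_
    rw [h.idxOf_rotate_lt_iff]
    constructor
    · rintro ⟨h1, h2⟩
      refine ⟨⟨?_, Or.inr h1⟩, h2⟩
      rintro rfl
      exact hpos h1 (hsing y h2)
    · rintro ⟨⟨h1, h2⟩, h3⟩
      refine ⟨h2.resolve_left ?_, h3⟩
      rintro rfl
      exact h1 (hsing x (hr.equiv.symm h3))
  · rw [hr.mem_right]
    refine exists_congr fun y => ?_
    rw [h.idxOf_rotate_lt_iff]
    constructor
    · rintro ⟨h1, h2⟩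
      refine ⟨⟨?_, Or.inr h1⟩, h2⟩
      rintro rfl
      exact hpos h1 (hsing x h2)
    · rintro ⟨⟨h1, h2⟩, h3⟩
      refine ⟨h2.resolve_left ?_, h3⟩
      rintro rfl
      exact h1 (hsing y (hr.equiv.symm h3))

/-- The top row exchanges `a` for the letter of rank `d e`, the bottom row exchanges the letter of
rank `d k` for `a`. These letters are the last and the second member of the class of `a`, whose
status is what changes when `a` becomes the largest letter. -/
theorem gromote_cons_of_twoRows (h : Adapted r (a :: L) T) {k e : ℕ}
    (ht : TwoRows c (a :: L).length (rowRank (a :: L) T 0) (rowRank (a :: L) T 1) k e) :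
    Adapted r (L ++ [a]) (gromote (a :: L) T) := by
  have hr := h.isNC
  set u := rowRank (a :: L) T 0 with hu
  set d := rowRank (a :: L) T 1 with hd
  have hidx := h.idxOf_gromote ht
  have htop : ∀ j : Fin c, (L ++ [a]).idxOf (gromote (a :: L) T (0, j)) + 1 =
      TwoRows.topOut u d e j := fun j =>
    (hidx (0, j)).trans (min_eq_right (ht.topOut_lt j.2).le)
  have hbot : ∀ j : Fin c, (L ++ [a]).idxOf (gromote (a :: L) T (1, j)) + 1 =
      min (a :: L).length (TwoRows.botOut d k j) := fun j => hidx (1, j)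
  have hec := ht.last_lt
  have hke := ht.first_le
  have hbotlt : ∀ j, j + 1 < c → TwoRows.botOut d k j < (a :: L).length := by
    intro j hj
    have f1 := ht.botOut_facts j
    have f2 := ht.bot_lt j
    have f3 := ht.bot_lt (j + 1)
    omega
  have hblock : ∀ x, r a x ∧ x ≠ a ↔
      ∃ j, j ≤ e ∧ d j ≤ u (j + 1) ∧ d j = (a :: L).idxOf x :=
    h.rel_first_iff ht List.idxOf_cons_self
  have hlt := h.idxOf_rotate_lt_iff
  have hinj : ∀ {x y}, (L ++ [a]).idxOf x = (L ++ [a]).idxOf y → x = y := fun {x y} hxy =>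
    (List.idxOf_inj ((List.perm_append_singleton a L).mem_iff.2 (h.mem x))).1 hxy
  have hrot : ∀ x, (L ++ [a]).idxOf x + 1 =
      if x = a then (a :: L).length else (a :: L).idxOf x := fun x =>
    idxOf_rotate h.nodup (h.mem x)
  have hletter : ∀ j (hj : j < c), (a :: L).idxOf (T (1, ⟨j, hj⟩)) = d j := fun j hj =>
    (rowRank_of_lt _ _ _ hj).symm
  have hzero : ∀ x, (a :: L).idxOf x = 0 ↔ x = a := idxOf_eq_zero_iff
  have htopmem : ∀ x, x ∈ Set.range (fun j => gromote (a :: L) T (0, j)) ↔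
      x ≠ a ∧ (x ∈ Set.range (fun j => T (0, j)) ∨ (a :: L).idxOf x = d e) := by
    intro x
    by_cases hx : x = a
    · refine iff_of_false ?_ fun h' => h'.1 hx
      rintro ⟨j, hj⟩
      have h1 := htop j
      have h2 := ht.topOut_lt j.2
      simp only at hj
      rw [hj, hrot, if_pos hx] at h1
      omega
    · have h1 : x ∈ Set.range (fun j => gromote (a :: L) T (0, j)) ↔
          ∃ j, j < c ∧ TwoRows.topOut u d e j = (a :: L).idxOf x := by
        constructor
        · rintro ⟨j, rfl⟩
          refine ⟨j, j.2, ?_⟩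
          rw [← htop, hrot, if_neg hx]
        · rintro ⟨j, hj, h2⟩
          refine ⟨⟨j, hj⟩, hinj ?_⟩
          have h3 := htop ⟨j, hj⟩
          have h4 := hrot x
          rw [if_neg hx] at h4
          simp only at h3 ⊢
          omega
      rw [h1, ht.exists_topOut_eq_iff, h.mem_row_iff]
      simp only [Ne, hzero, hx, not_false_eq_true, true_and, ← hu]
  have hbotmem : ∀ x, x ∈ Set.range (fun j => gromote (a :: L) T (1, j)) ↔
      x = a ∨ (x ∈ Set.range (fun j => T (1, j)) ∧ (a :: L).idxOf x ≠ d k) := by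
    intro x
    by_cases hx : x = a
    -- The last bottom box ends with value `d c`, which lies outside the alphabet, so it receives
    -- `a`.
    · refine iff_of_true ⟨⟨c - 1, by omega⟩, hinj ?_⟩ (Or.inl hx)
      have h1 := hbot ⟨c - 1, by omega⟩
      have h2 := hrot x
      have f1 := ht.botOut_facts (c - 1)
      have f2 := ht.bot_lt (c - 1 + 1)
      rw [if_pos hx] at h2
      simp only at h1 ⊢
      omega
    · have h1 : x ∈ Set.range (fun j => gromote (a :: L) T (1, j)) ↔
          ∃ j, j < c ∧ TwoRows.botOut d k j = (a :: L).idxOf x := by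
        have hxN := h.idxOf_lt x
        have h4 := hrot x
        rw [if_neg hx] at h4
        constructor
        · rintro ⟨j, rfl⟩
          refine ⟨j, j.2, ?_⟩
          have h3 := hbot j
          simp only at h3 h4 hxN ⊢
          omega
        · rintro ⟨j, hj, h2⟩
          refine ⟨⟨j, hj⟩, hinj ?_⟩
          have h3 := hbot ⟨j, hj⟩
          simp only at h3 ⊢
          omega
      rw [h1, ht.exists_botOut_eq_iff (h.idxOf_lt x), h.mem_row_iff]
      simp only [hx, false_or, ← hd]
      exact and_comm.trans (and_congr_right fun _ => Iff.rfl)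
  have hposlt : ∀ {x y}, (a :: L).idxOf x < (a :: L).idxOf y → y ≠ a := by
    rintro x y hxy rfl
    simp at hxy
  refine ⟨?_, ?_, ?_, ?_, hr.equiv, h.noncrossing_rotate, fun x => ?_, fun x => ?_⟩
  · exact (List.perm_append_singleton a L).nodup_iff.2 h.nodup
  · exact fun x => (List.perm_append_singleton a L).mem_iff.2 (h.mem x)
  · intro i j j' hj
    have hjj : j.val < j'.val := hj
    have hj' := j'.2
    obtain rfl | rfl : i = 0 ∨ i = 1 := by omega
    · have h1 := htop j
      have h2 := htop j'
      have h3 := ht.topOut_strictMono hjj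
      simp only
      omega
    · have h1 := hbot j
      have h2 := hbot j'
      have h3 := ht.botOut_strictMono hjj
      have h4 := hbotlt j (by omega)
      simp only
      omega
  · intro j
    have h1 := htop j
    have h2 := hbot j
    have h3 := ht.topOut_lt_botOut j
    have h4 := ht.topOut_lt j.2
    omega
  · rw [htopmem]
    constructor
    · rintro ⟨hx, hx' | hx'⟩
      · obtain ⟨y, h1, h2⟩ := (hr.mem_left x).1 hx'
        exact ⟨y, (hlt x y).2 ⟨hx, Or.inr h1⟩, h2⟩
      · have := (hblock x).2 ⟨e, le_rfl, ht.last.le, hx'.symm⟩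
        exact ⟨a, (hlt x a).2 ⟨hx, Or.inl rfl⟩, hr.equiv.symm this.1⟩
    · rintro ⟨y, h1, h2⟩
      obtain ⟨hx, h1⟩ := (hlt x y).1 h1
      refine ⟨hx, ?_⟩
      by_cases hy : y = a
      · rw [hy] at h2
        obtain ⟨j, h3, h4, h5⟩ := (hblock x).1 ⟨hr.equiv.symm h2, hx⟩
        rcases h3.eq_or_lt with rfl | h3
        · exact Or.inr h5.symm
        -- For `j < e` the two inequalities give `d j = u (j + 1)`: the letter was already in the
        -- top row.
        · refine Or.inl ((h.mem_row_iff 0 x).2 ⟨j + 1, by omega, ?_⟩)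
          have := ht.before_last j h3
          rw [← h5]
          exact le_antisymm this h4
      · exact Or.inl ((hr.mem_left x).2 ⟨y, h1.resolve_left hy, h2⟩)
  · rw [hbotmem]
    constructor
    · rintro (rfl | ⟨h1, h2⟩)
      · have := (hblock (T (1, ⟨e, hec⟩))).2 ⟨e, le_rfl, ht.last.le, (hletter e hec).symm⟩
        exact ⟨_, (hlt _ _).2 ⟨this.2, Or.inl rfl⟩, hr.equiv.symm this.1⟩
      · obtain ⟨y, h3, h4⟩ := (hr.mem_right x).1 h1
        by_cases hy : y = a
        · rw [hy] at h4
          have hxa := hposlt h3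
          obtain ⟨j, h5, h6, h7⟩ := (hblock x).1 ⟨h4, hxa⟩
          have h8 := ht.le_of_first h6
          have h9 : k < j := by
            refine h8.lt_of_ne ?_
            rintro rfl
            exact h2 h7.symm
          have hkc : k < c := by omega
          -- The smaller related letter was `a`, which is now the largest; the letter of rank `d k`
          -- takes its place.
          have := (hblock (T (1, ⟨k, hkc⟩))).2 ⟨k, hke, ht.first, (hletter k hkc).symm⟩
          refine ⟨_, (hlt _ _).2 ⟨this.2, Or.inr ?_⟩,
            hr.equiv.trans (hr.equiv.symm this.1) h4⟩
          rw [hletter, ← h7]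
          exact ht.bot h9
        · exact ⟨y, (hlt _ _).2 ⟨hy, Or.inr h3⟩, h4⟩
    · rintro ⟨y, h1, h2⟩
      obtain ⟨hy, h1⟩ := (hlt y x).1 h1
      by_cases hx : x = a
      · exact Or.inl hx
      · have h1 := h1.resolve_left hx
        refine Or.inr ⟨(hr.mem_right x).2 ⟨y, h1, h2⟩, fun hk => ?_⟩
        have h3 := ((hblock x).2 ⟨k, hke, ht.first, hk.symm⟩).1
        obtain ⟨j, h4, h5, h6⟩ := (hblock y).1 ⟨hr.equiv.trans h3 (hr.equiv.symm h2), hy⟩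
        have h7 := ht.bot.monotone (ht.le_of_first h5)
        omega

/-- K-gromotion preserves the associated noncrossing relation. -/
theorem gromote (h : Adapted r A T) : Adapted r (A.rotate 1) (TripProm.gromote A T) := by
  cases A with
  | nil => simpa [TripProm.gromote] using h
  | cons a L =>
    rw [List.rotate_cons_succ, List.rotate_zero]
    by_cases hb : ∀ b, T b ≠ a
    · rw [gromote_of_notMem hb]
      exact h.gromote_cons_of_notMem hb
    · push Not at hb
      obtain ⟨b, hb⟩ := hb
      obtain ⟨k, e, ht⟩ := h.exists_twoRows (b := b) (by rw [hb, List.idxOf_cons_self])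
      exact h.gromote_cons_of_twoRows ht

theorem iterate (h : Adapted r A T) (n : ℕ) :
    Adapted r (gromotion^[n] (A, T)).1 (gromotion^[n] (A, T)).2 ∧
      (gromotion^[n] (A, T)).1 = A.rotate n := by
  induction n with
  | zero => exact ⟨h, by simp⟩
  | succ n ih =>
    rw [Function.iterate_succ_apply']
    refine ⟨ih.1.gromote, ?_⟩
    rw [gromotion, ih.2, List.rotate_rotate]

end Adapted

/-! ### The promotion digraph of a tableau -/

namespace IncTableau

variable {c q : ℕ} (T : IncTableau 2 c q)

theorem adapted_of_isNC {r : Fin q → Fin q → Prop}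
    (h : IsNC Fin.val r (Set.range fun j => T.entry (0, j)) (Set.range fun j => T.entry (1, j))) :
    Adapted r (List.finRange q) T.entry where
  nodup := List.nodup_finRange q
  mem := List.mem_finRange
  row i j j' hj := by
    simpa [List.idxOf_finRange] using T.row_strict i hj
  col j := by
    simpa [List.idxOf_finRange] using T.col_strict j (show (0 : Fin 2) < 1 by decide)
  isNC := by simpa [List.idxOf_finRange] using h

theorem prom_one_adj_iff {r : Fin q → Fin q → Prop}
    (h : IsNC Fin.val r (Set.range fun j => T.entry (0, j)) (Set.range fun j => T.entry (1, j)))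
    (x y : Fin q) : (T.prom 1).Adj x y ↔ r x y ∧ y ≠ x := by
  obtain ⟨h1, h2⟩ := (T.adapted_of_isNC h).iterate x
  change MovesUp _ _ 1 y ↔ _
  -- Values count from `0`, so after `x` rotations the first letter is `x`, and `movesUp_iff`
  -- applies with `a = x`.
  have hhead : ((List.finRange q).rotate x).head? = some x := by
    rw [List.head?_rotate (by simp)]
    simp
  rw [← h2] at hhead
  generalize (gromotion^[x.val] (List.finRange q, T.entry)).1 = A at *
  cases A with
  | nil => simp at hhead
  | cons a L =>
    obtain rfl : a = x := by simpa using hhead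
    exact h1.movesUp_iff y

end IncTableau

namespace NoncrossingPartition

variable {q : ℕ} (P : NoncrossingPartition q)

/-! ## Trips -/

theorem degree_toPlabicGraph (v : P.Block) : P.toPlabicGraph.degree v = v.1.card := by
  rw [← Nat.card_eq_finsetCard]
  symm
  have hv : ∀ k, k ∈ v.1 → P.block k = v.1 := fun k => P.toFinpartition.part_eq_of_mem v.2
  refine Nat.card_congr (Equiv.ofBijective
    (fun k => ⟨Sum.inr k.1, congrArg Sum.inr (Subtype.ext (hv k.1 k.2))⟩) ⟨?_, ?_⟩)
  · intro j k h
    exact Subtype.ext (Sum.inr.inj (congrArg Subtype.val h))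
  · rintro ⟨k | k, hk⟩
    · exact absurd hk Sum.inl_ne_inr
    · have h : P.block k = v.1 := congrArg Subtype.val (Sum.inr.inj hk)
      exact ⟨⟨k, h ▸ P.self_mem_block k⟩, rfl⟩

theorem isCycleOn_next (k : Fin q) : P.next.IsCycleOn (P.block k : Set (Fin q)) := by
  constructor
  · refine ⟨fun x hx => ?_, P.next.injective.injOn, fun x hx => ?_⟩
    · rw [Finset.mem_coe, mem_block_iff] at hx ⊢
      rw [block_next, hx]
    · refine ⟨P.next.symm x, ?_, by simp⟩
      rw [Finset.mem_coe, mem_block_iff] at hx ⊢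
      rw [← hx, ← P.block_next (P.next.symm x), Equiv.apply_symm_apply]
  · intro x hx y hy
    rw [Finset.mem_coe, mem_block_iff] at hx hy
    exact P.block_eq_iff_sameCycle.1 (hx.trans hy.symm)

theorem dartRot_pow_inr (m : ℕ) (k : Fin q) :
    (P.dartRot ^ m) (Sum.inr k) = Sum.inr ((P.next ^ m) k) := by
  induction m with
  | zero => rfl
  | succ m ih => rw [pow_succ', Equiv.Perm.mul_apply, ih, pow_succ']; rfl

theorem tripStep_inl_iff (i r : ℕ) (k : Fin q) (d : Fin q ⊕ Fin q) :
    P.toPlabicGraph.TripStep i r (Sum.inl k) d ↔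
      ∃ l, l + r ≤ (P.block k).card ∧ d = Sum.inr ((P.next ^ (i + l)) k) := by
  constructor
  · rintro ⟨v, hv, l, hl, rfl⟩
    obtain rfl : ⟨P.block k, P.block_mem k⟩ = v := Sum.inr.inj hv
    rw [degree_toPlabicGraph] at hl
    exact ⟨l, hl, P.dartRot_pow_inr _ _⟩
  · rintro ⟨l, hl, rfl⟩
    refine ⟨⟨P.block k, P.block_mem k⟩, rfl, l, ?_, (P.dartRot_pow_inr _ _).symm⟩
    rwa [degree_toPlabicGraph]

theorem not_tripStep_inr (i r : ℕ) (k : Fin q) (d : Fin q ⊕ Fin q) :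
    ¬ P.toPlabicGraph.TripStep i r (Sum.inr k) d := by
  rintro ⟨v, hv, -⟩
  exact Sum.inl_ne_inr hv

/-- Every `(1, 2)`-trip from `x` leaves the block of `x` at another of its elements. -/
theorem trip_one_two_adj_iff (x y : Fin q) :
    (P.toPlabicGraph.trip 1 2).Adj x y ↔ P.block x = P.block y ∧ y ≠ x := by
  have hc := P.isCycleOn_next x
  have hx := P.self_mem_block x
  constructor
  · rintro ⟨d, hd, hy⟩
    rcases hd.cases_head with rfl | ⟨d', h1, h2⟩
    · exact absurd hy Sum.inr_ne_inl
    · obtain ⟨l, hl, rfl⟩ := (P.tripStep_inl_iff 1 2 x d').1 h1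
      rcases h2.cases_head with rfl | ⟨d'', h3, -⟩
      · obtain rfl : (P.next ^ (1 + l)) x = y := Sum.inl.inj hy
        refine ⟨(P.next_pow_apply x _).2.symm, fun h => ?_⟩
        -- From `l + 2 ≤ h`, where `h` is the size of the block, the exponent `1 + l` lies strictly
        -- between `0` and `h`, so it is no multiple of the cycle length.
        have := Nat.le_of_dvd (by omega) ((hc.pow_apply_eq hx).1 h)
        omega
      · exact absurd h3 (P.not_tripStep_inr _ _ _ _)
  · rintro ⟨h1, h2⟩
    obtain ⟨n, hn, rfl⟩ := hc.exists_pow_eq hx (P.mem_block_iff.2 h1.symm)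
    have hn0 : n ≠ 0 := by
      rintro rfl
      exact h2 rfl
    refine ⟨Sum.inr ((P.next ^ n) x), Relation.ReflTransGen.single ?_, rfl⟩
    exact (P.tripStep_inl_iff 1 2 x _).2 ⟨n - 1, by omega, by rw [Nat.add_sub_cancel' (by omega)]⟩

/-! ## The partition of a tableau -/

/-- The propositional core of `IsAssociated`: `t` and `b` stand for occurrence in the top and bottom
row, `hi` and `lo` for the block having a larger and a smaller element. -/
theorem least_greatest_iff (t b hi lo : Prop) :
    ((¬ hi ∧ ¬ lo ↔ ¬ t ∧ ¬ b) ∧ (¬ (¬ hi ∧ ¬ lo) ∧ ¬ lo ↔ t ∧ ¬ b) ∧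
      (¬ (¬ hi ∧ ¬ lo) ∧ ¬ hi ↔ ¬ t ∧ b) ∧ (t ∧ b → ¬ ¬ lo ∧ ¬ ¬ hi)) ↔
      (t ↔ hi) ∧ (b ↔ lo) := by
  by_cases t <;> by_cases b <;> by_cases hi <;> by_cases lo <;> simp [*]

theorem isAssociated_iff {c : ℕ} (T : IncTableau 2 c q) :
    P.IsAssociated T ↔ IsNC Fin.val (fun x y => P.block x = P.block y)
      (Set.range fun j => T.entry (0, j)) (Set.range fun j => T.entry (1, j)) := by
  have hsing : ∀ i, P.block i = {i} ↔ (¬ ∃ k, i.val < k.val ∧ P.block i = P.block k) ∧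
      ¬ ∃ k, k.val < i.val ∧ P.block k = P.block i := by
    intro i
    rw [Finset.eq_singleton_iff_unique_mem]
    simp only [P.self_mem_block, true_and, mem_block_iff]
    constructor
    · intro h
      constructor
      · rintro ⟨k, h1, h2⟩
        rw [h k h2.symm] at h1
        omega
      · rintro ⟨k, h1, h2⟩
        rw [h k h2] at h1
        omega
    · rintro ⟨h1, h2⟩ k hk
      rcases lt_trichotomy k i with h | h | h
      · exact absurd ⟨k, h, hk⟩ h2
      · exact h
      · exact absurd ⟨k, h, hk.symm⟩ h1
  have hlo : ∀ i, (∀ k ∈ P.block i, i ≤ k) ↔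
      ¬ ∃ k, k.val < i.val ∧ P.block k = P.block i := by
    intro i
    simp only [mem_block_iff, not_exists, not_and']
    exact forall₂_congr fun k _ => not_lt.symm
  have hhi : ∀ i, (∀ k ∈ P.block i, k ≤ i) ↔
      ¬ ∃ k, i.val < k.val ∧ P.block i = P.block k := by
    intro i
    simp only [mem_block_iff, not_exists, not_and', eq_comm (a := P.block i)]
    exact forall₂_congr fun k _ => not_lt.symm
  have key : P.IsAssociated T ↔ ∀ i, ((∃ j, T.entry (0, j) = i) ↔
      ∃ k, i.val < k.val ∧ P.block i = P.block k) ∧ ((∃ j, T.entry (1, j) = i) ↔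
      ∃ k, k.val < i.val ∧ P.block k = P.block i) := by
    unfold IsAssociated
    refine forall_congr' fun i => ?_
    simp only [Ne, hsing, hlo, hhi]
    exact least_greatest_iff _ _ _ _
  rw [key]
  constructor
  · intro h
    exact ⟨⟨fun _ => rfl, Eq.symm, Eq.trans⟩, P.noncrossing, fun x => (h x).1, fun x => (h x).2⟩
  · exact fun h i => ⟨h.mem_left i, h.mem_right i⟩

theorem eq_of_block_eq_iff {P Q : NoncrossingPartition q}
    (h : ∀ x y, P.block x = P.block y ↔ Q.block x = Q.block y) : P = Q := by
  have hb : ∀ x, P.block x = Q.block x := fun x => by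
    ext y
    rw [mem_block_iff, mem_block_iff, h]
  have hparts : ∀ (R : NoncrossingPartition q) (B : Finset (Fin q)),
      B ∈ R.toFinpartition.parts ↔ ∃ x, R.block x = B := by
    intro R B
    constructor
    · intro hB
      obtain ⟨x, hx⟩ := R.toFinpartition.nonempty_of_mem_parts hB
      exact ⟨x, R.toFinpartition.part_eq_of_mem hB hx⟩
    · rintro ⟨x, rfl⟩
      exact R.block_mem x
  refine NoncrossingPartition.ext (Finpartition.ext ?_)
  ext B
  simp only [hparts, hb]

theorem IsAssociated.unique {P Q : NoncrossingPartition q} {c : ℕ} {T : IncTableau 2 c q}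
    (hP : P.IsAssociated T) (hQ : Q.IsAssociated T) : P = Q :=
  eq_of_block_eq_iff fun _ _ => ((P.isAssociated_iff T).1 hP).unique Fin.val_injective
    ((Q.isAssociated_iff T).1 hQ)

theorem exists_isAssociated {c : ℕ} (T : IncTableau 2 c q) :
    ∃ P : NoncrossingPartition q, P.IsAssociated T := by
  classical
  have h := isNC_of_rows Fin.val_injective (u := fun j => T.entry (0, j))
    (d := fun j => T.entry (1, j)) (T.row_strict 0) (T.row_strict 1)
    fun j => T.col_strict j (show (0 : Fin 2) < 1 by decide)
  let s : Setoid (Fin q) := ⟨_, h.equiv⟩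
  have hs : ∀ x y, (Finpartition.ofSetoid s).part x = (Finpartition.ofSetoid s).part y ↔
      s x y := by
    intro x y
    rw [← (Finpartition.ofSetoid s).mem_part_iff_part_eq_part (Finset.mem_univ _)
      (Finset.mem_univ _), Finpartition.mem_part_ofSetoid_iff_rel]
    exact Setoid.comm' s
  let P : NoncrossingPartition q := ⟨Finpartition.ofSetoid s, fun a b c d h1 h2 h3 h4 h5 => by
    rw [hs] at h4 h5 ⊢
    exact h.noncrossing a b c d h1 h2 h3 h4 h5⟩
  have hP : ∀ x y, P.block x = P.block y ↔ s x y := hs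
  refine ⟨P, (P.isAssociated_iff T).2 ?_⟩
  simp only [hP]
  exact h

/-! ### Bijectivity: recovering the tableau from the partition -/

theorem lt_next_iff (k : Fin q) : k < P.next k ↔ ∃ m, k < m ∧ P.block k = P.block m := by
  constructor
  · exact fun h => ⟨_, h, (P.block_next k).symm⟩
  · rintro ⟨m, h1, h2⟩
    by_contra h
    exact absurd (P.le_of_next_le (not_lt.1 h) h2.symm) (not_le.2 h1)

theorem symm_next_lt_iff (k : Fin q) :
    P.next.symm k < k ↔ ∃ m, m < k ∧ P.block m = P.block k := by
  have hb : P.block (P.next.symm k) = P.block k := by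
    rw [← P.block_next (P.next.symm k), Equiv.apply_symm_apply]
  refine ⟨fun h => ⟨_, h, hb⟩, ?_⟩
  rintro ⟨m, h1, h2⟩
  -- Minimizing `q - m` selects the largest element of the block below `k`, whose successor must be
  -- `k`.
  obtain ⟨m, ⟨h1, h2⟩, h3⟩ :=
    exists_minimal_value (p := fun m => m < k ∧ P.block m = P.block k)
      (fun m : Fin q => q - m.val) ⟨m, h1, h2⟩
  have hlt := (P.lt_next_iff m).2 ⟨k, h1, h2⟩
  suffices P.next m = k by
    rwa [← this, Equiv.symm_apply_apply, this]
  rcases lt_trichotomy (P.next m) k with h | h | h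
  · have := h3 _ ⟨h, (P.block_next m).trans h2⟩
    have h4 : m.val < (P.next m).val := hlt
    have := m.2
    have := (P.next m).2
    omega
  · exact h
  · exact absurd h2.symm (P.next_between h1 h)

/-- If `d j ≤ u j`, then `u (σ l) < d l ≤ d j ≤ u j` for all `l ≤ j`, so `σ` would inject `j + 1`
indices into the `j` indices below `j`. -/
theorem lt_of_matching {c : ℕ} {u d : Fin c → ℕ} (hu : StrictMono u) (hd : StrictMono d)
    (σ : Fin c → Fin c) (hσ : Function.Injective σ) (h : ∀ j, u (σ j) < d j) (j : Fin c) :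
    u j < d j := by
  by_contra hj
  have h1 : (Finset.Iic j).image σ ⊆ Finset.Iio j := by
    intro i hi
    obtain ⟨l, hl, rfl⟩ := Finset.mem_image.1 hi
    have h2 := h l
    have h3 := hd.monotone (Finset.mem_Iic.1 hl)
    exact Finset.mem_Iio.2 (hu.lt_iff_lt.1 (by omega))
  have h2 := Finset.card_le_card h1
  rw [Finset.card_image_of_injective _ hσ, Fin.card_Iic, Fin.card_Iio] at h2
  omega

/-- The rows are the sorted openers and closers. The permutation `next` maps openers bijectively to
closers, so the rows have equal length; as each closer exceeds its predecessor, `lt_of_matching`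
makes the columns strict. -/
theorem exists_tableau : ∃ (c : ℕ) (T : IncTableau 2 c q), P.IsAssociated T := by
  let U : Finset (Fin q) := Finset.univ.filter fun k => k < P.next k
  let D : Finset (Fin q) := Finset.univ.filter fun k => P.next.symm k < k
  have hUD : D = U.map P.next.toEmbedding := by
    ext k
    simp [U, D, Finset.mem_map_equiv]
  have hcard : D.card = U.card := by rw [hUD, Finset.card_map]
  let u := U.orderEmbOfFin rfl
  let d := D.orderEmbOfFin hcard
  have hur : Set.range u = U := Finset.range_orderEmbOfFin _ _
  have hdr : Set.range d = D := Finset.range_orderEmbOfFin _ _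
  have hex : ∀ j, ∃ i, u i = P.next.symm (d j) := by
    intro j
    have h1 : d j ∈ D := Finset.orderEmbOfFin_mem _ _ _
    have h2 : P.next.symm (d j) ∈ (U : Set (Fin q)) := by simpa [U, D] using h1
    rwa [← hur] at h2
  choose σ hσ using hex
  have hσi : Function.Injective σ := by
    intro i j hij
    have := (hσ i).symm.trans ((congrArg u hij).trans (hσ j))
    exact d.injective (P.next.symm.injective this)
  have hcol : ∀ j, u j < d j := by
    refine lt_of_matching (u := fun j => (u j).val) (d := fun j => (d j).val) u.strictMono
      d.strictMono σ hσi fun j => ?_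
    have h1 : d j ∈ D := Finset.orderEmbOfFin_mem _ _ _
    simp only [hσ]
    simpa [D] using h1
  let T : IncTableau 2 U.card q :=
    { entry := fun b => if b.1 = 0 then u b.2 else d b.2
      row_strict := by
        intro i
        obtain rfl | rfl : i = 0 ∨ i = 1 := by omega
        · exact u.strictMono
        · exact d.strictMono
      col_strict := by
        intro j i i' hi
        obtain ⟨rfl, rfl⟩ : i = 0 ∧ i' = 1 := by omega
        exact hcol j }
  refine ⟨U.card, T, (P.isAssociated_iff T).2
    ⟨⟨fun _ => rfl, Eq.symm, Eq.trans⟩, P.noncrossing, fun x => ?_, fun x => ?_⟩⟩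
  · change x ∈ Set.range u ↔ _
    rw [hur]
    simpa [U] using P.lt_next_iff x
  · change x ∈ Set.range d ↔ _
    rw [hdr]
    simpa [D] using P.symm_next_lt_iff x

/-- The partition fixes the set of entries of each row, and a strictly increasing row is determined
by its set; the number of columns is its cardinality. -/
theorem IsAssociated.eq_tableau {P : NoncrossingPartition q} {c c' : ℕ} {T : IncTableau 2 c q}
    {T' : IncTableau 2 c' q} (h : P.IsAssociated T) (h' : P.IsAssociated T') :
    (⟨c, T⟩ : Σ c, IncTableau 2 c q) = ⟨c', T'⟩ := by
  rw [isAssociated_iff] at h h'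
  have h0 : (Set.range fun j => T.entry (0, j)) = Set.range fun j => T'.entry (0, j) :=
    Set.ext fun x => (h.mem_left x).trans (h'.mem_left x).symm
  have h1 : (Set.range fun j => T.entry (1, j)) = Set.range fun j => T'.entry (1, j) :=
    Set.ext fun x => (h.mem_right x).trans (h'.mem_right x).symm
  obtain rfl : c = c' := by
    have h4 := congrArg Set.ncard h0
    rw [← Nat.card_coe_set_eq, ← Nat.card_coe_set_eq,
      Nat.card_range_of_injective (T.row_strict 0).injective,
      Nat.card_range_of_injective (T'.row_strict 0).injective] at h4
    simpa using h4
  have e0 := ((T.row_strict 0).range_inj (T'.row_strict 0)).1 h0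
  have e1 := ((T.row_strict 1).range_inj (T'.row_strict 1)).1 h1
  congr 1
  ext ⟨i, j⟩
  obtain rfl | rfl : i = 0 ∨ i = 1 := by omega
  · exact congrArg Fin.val (congrFun e0 j)
  · exact congrArg Fin.val (congrFun e1 j)

end NoncrossingPartition
end TripProm

theorem mainTheorem6 (q : ℕ) :
    ∃ π : (Σ c : ℕ, TripProm.IncTableau 2 c q) → TripProm.NoncrossingPartition q,
      Function.Bijective π ∧
      (∀ (c : ℕ) (T : TripProm.IncTableau 2 c q) (P : TripProm.NoncrossingPartition q),
        P.IsAssociated T ↔ P = π ⟨c, T⟩) ∧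
      ∀ (c : ℕ) (T : TripProm.IncTableau 2 c q),
        (π ⟨c, T⟩).toPlabicGraph.trip 1 2 = T.prom 1 := by
  choose π hπ using fun T : Σ c : ℕ, TripProm.IncTableau 2 c q =>
    TripProm.NoncrossingPartition.exists_isAssociated T.2
  refine ⟨π, ⟨fun T T' h => ?_, fun P => ?_⟩, fun c T P => ⟨fun h => h.unique (hπ ⟨c, T⟩), ?_⟩,
    fun c T => ?_⟩
  · exact (hπ T).eq_tableau (h ▸ hπ T')
  · obtain ⟨c, T, hT⟩ := P.exists_tableau
    exact ⟨⟨c, T⟩, (hπ ⟨c, T⟩).unique hT⟩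
  · rintro rfl
    exact hπ ⟨c, T⟩
  · ext x y
    rw [TripProm.NoncrossingPartition.trip_one_two_adj_iff,
      T.prom_one_adj_iff (((π ⟨c, T⟩).isAssociated_iff T).1 (hπ ⟨c, T⟩))]
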